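/- **Proposition (Buchstaber–Leykin).** Let $e,q$ be coprime integers with $2\le e<q$, put $2g=(e-1)(q-1)$, and assume that the $(e,q)$-curve has modality $0$: the number of pairs $(i,j)$ with $0\le i\le q-2$, $0\le j\le e-2$ and $ei+qj<eq$ equals $2g$, i.e. every pair in this range satisfies $ei+qj<eq$. (This happens exactly for $(e,q)=(2,2g+1)$, $(3,4)$ and $(3,5)$.) Let $$f(x,y)=y^e-x^q-\sum_{0\le i\le q-2,\ 0\le j\le e-2}\mu_{eq-ei-qj}\,x^iy^j$$ be the Weierstrass form of the curve, the $2g$ parameters $\mu_k$ being indeterminates, and write $f_x=\partial f/\partial x$, $f_y=\partial f/\partial y$ and $$\operatorname{Hess}f=\det\begin{pmatrix} f_{xx}& f_{xy}\\ f_{yx}& f_{yy}\end{pmatrix}.$$ Let $M_1,\dots,M_{2g}$ be the monomials $x^iy^j$ ($0\le i\le q-2$, $0\le j\le e-2$) in some order, let $M$ be the column vector with these entries, and let $v_k=ei+qj$ for $M_k=x^iy^j$. Put $$H\big((x,y),(z,w)\big)=\frac12\det\begin{pmatrix}\dfrac{f_x(x,y)-f_x(z,w)}{x-z}&\dfrac{f_y(x,y)-f_y(z,w)}{x-z}\\[2mm]\dfrac{f_x(z,y)-f_x(x,w)}{y-w}&\dfrac{f_y(z,y)-f_y(x,w)}{y-w}\end{pmatrix},$$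 which is a polynomial in $\mathbb Q[\mu][x,y,z,w]$. Let $V=(V_{kl})$ be a $2g\times 2g$ matrix over $\mathbb Q[\mu]$ with $${}^tM(x,y)\,V\,M(z,w)=f(x,y)\,H\big((x,y),(z,w)\big)\quad\text{in}\quad \mathbb Q[\mu][x,y,z,w]\big/\big(f_x(x,y),f_y(x,y),f_x(z,w),f_y(z,w)\big).$$ Put $L_k=\sum_{l=1}^{2g}V_{kl}\,\dfrac{\partial}{\partial\mu_{eq-v_l}}$ and $L=\sum_{k=1}^{2g}M_k(x,y)\,L_k$. Let $\varDelta$ be the discriminant of the curve: a polynomial of least degree among the polynomials in the $\mu_k$ with integer coefficients of greatest common divisor $1$ whose zeros $\mu\in\mathbb C^{2g}$ are exactly the parameters for which the affine curve $f=0$ over $\mathbb C$ has a singular point. Then such a matrix $V$ and such a polynomial $\varDelta$ exist, and for every such $V$ and $\varDelta$ $$L(\varDelta)=-\operatorname{Hess}f\cdot\varDelta\qquad\text{in}\quad \mathbb Q[\mu][x,y]/(f_x,f_y).$$ -/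

import Mathlib

open MvPolynomial

namespace PlaneTelescopic

/-- Exponent pairs `(i, j)` with `0 ≤ i ≤ q - 2` and `0 ≤ j ≤ e - 2`. They index the `2g` monomials
`x ^ i * y ^ j` forming the vector `M(x,y)`, as well as the parameters:
`μ (i, j)` is the parameter of weight `e q - e i - q j`. -/
abbrev Idx (e q : ℕ) : Type := Fin (q - 1) × Fin (e - 1)

/-- The exponents `(i, j)` of the terms `μ_{eq - ei - qj} x ^ i y ^ j` of the Weierstrass form: the
general `(e,q)`-curve has the terms with `e i + q j < e q`, and the terms with `y ^ (e - 1)` and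
the term `x ^ (q - 1)` have been removed. (For `1 ≤ j` and `e < q`, the bound `i ≤ q - 2` is a
consequence of `e i + q j < e q`.) -/
def weierstrassSupport (e q : ℕ) : Finset (Idx e q) :=
  Finset.univ.filter fun k => e * (k.1 : ℕ) + q * (k.2 : ℕ) < e * q

/-- The modality: `2g = (e - 1)(q - 1)` minus the number of parameters of the Weierstrass form. -/
def modality (e q : ℕ) : ℤ :=
  ((e : ℤ) - 1) * ((q : ℤ) - 1) - ((weierstrassSupport e q).card : ℤ)

section Curve

variable {A : Type*} [CommRing A] {e q : ℕ}

/-- The monomial `x ^ i y ^ j` (the variable `X 0` is `x`, and `X 1` is `y`). -/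
noncomputable def mono (A : Type*) [CommRing A] (k : Idx e q) : MvPolynomial (Fin 2) A :=
  X 0 ^ (k.1 : ℕ) * X 1 ^ (k.2 : ℕ)

/-- The defining polynomial in Weierstrass form
`f(x,y) = y ^ e - x ^ q - ∑ μ_{eq - ei - qj} x ^ i y ^ j`, with parameters in a ring `A`. -/
noncomputable def curvePoly (μ : Idx e q → A) : MvPolynomial (Fin 2) A :=
  X 1 ^ e - X 0 ^ q - ∑ k ∈ weierstrassSupport e q, C (μ k) * mono A k

/-- The affine curve `f = 0` has a singular point with coordinates in `A`. -/
def HasSingularPoint (μ : Idx e q → A) : Prop :=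
  ∃ P : Fin 2 → A, eval P (curvePoly μ) = 0 ∧
    eval P (pderiv 0 (curvePoly μ)) = 0 ∧ eval P (pderiv 1 (curvePoly μ)) = 0

end Curve

/-- `ℚ[μ]`, the parameters being indeterminates. -/
abbrev ParamRing (e q : ℕ) : Type := MvPolynomial (Idx e q) ℚ

/-- The polynomial `f ∈ ℚ[μ][x,y]` with indeterminate parameters. -/
noncomputable def genericPoly (e q : ℕ) : MvPolynomial (Fin 2) (ParamRing e q) :=
  curvePoly (fun k => X k)

/-- `f₁ = ∂f/∂x`. -/
noncomputable def fx (e q : ℕ) : MvPolynomial (Fin 2) (ParamRing e q) := pderiv 0 (genericPoly e q)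

/-- `f₂ = ∂f/∂y`. -/
noncomputable def fy (e q : ℕ) : MvPolynomial (Fin 2) (ParamRing e q) := pderiv 1 (genericPoly e q)

/-- The ideal `(f_x, f_y)` of `ℚ[μ][x,y]`. -/
noncomputable def jacobianIdeal (e q : ℕ) : Ideal (MvPolynomial (Fin 2) (ParamRing e q)) :=
  Ideal.span {fx e q, fy e q}

/-- The Hessian determinant of a polynomial in `x` and `y`. -/
noncomputable def hess {A : Type*} [CommRing A] (p : MvPolynomial (Fin 2) A) :
    MvPolynomial (Fin 2) A :=
  Matrix.det !![pderiv 0 (pderiv 0 p), pderiv 0 (pderiv 1 p);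
                pderiv 1 (pderiv 0 p), pderiv 1 (pderiv 1 p)]

/-! In `MvPolynomial (Fin 4) A`, the variables `X 0, X 1, X 2, X 3` are `x, y, z, w`. -/

section Four

variable {A : Type*} [CommRing A]

/-- `p(u, v)`, for `p` a polynomial in two variables and `u, v` polynomials in `x, y, z, w`. -/
noncomputable def sub (p : MvPolynomial (Fin 2) A) (u v : MvPolynomial (Fin 4) A) :
    MvPolynomial (Fin 4) A :=
  aeval ![u, v] p

/-- The determinant with rows `(p₁(x,y) - p₁(z,w), p₂(x,y) - p₂(z,w))` and
`(p₁(z,y) - p₁(x,w), p₂(z,y) - p₂(x,w))`. -/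
noncomputable def bezoutNumerator (p₁ p₂ : MvPolynomial (Fin 2) A) : MvPolynomial (Fin 4) A :=
  Matrix.det
    !![sub p₁ (X 0) (X 1) - sub p₁ (X 2) (X 3), sub p₂ (X 0) (X 1) - sub p₂ (X 2) (X 3);
       sub p₁ (X 2) (X 1) - sub p₁ (X 0) (X 3), sub p₂ (X 2) (X 1) - sub p₂ (X 0) (X 3)]

lemma aeval_sub (p : MvPolynomial (Fin 2) A) (u v : MvPolynomial (Fin 4) A)
    (s : Fin 4 → MvPolynomial (Fin 4) A) :
    aeval s (sub p u v) = sub p (aeval s u) (aeval s v) := by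
  unfold sub
  rw [← AlgHom.comp_apply, comp_aeval]
  congr 2
  funext i
  fin_cases i <;> rfl

lemma dvd_sub_aeval (d : MvPolynomial (Fin 4) A) (s : Fin 4 → MvPolynomial (Fin 4) A)
    (hs : ∀ i, d ∣ X i - s i) (p : MvPolynomial (Fin 4) A) : d ∣ p - aeval s p := by
  induction p using MvPolynomial.induction_on with
  | C a => simp
  | add p r hp hr =>
    have h := dvd_add hp hr
    rw [map_add]
    convert h using 1
    ring
  | mul_X p i hp =>
    have h := dvd_add (hp.mul_right (X i)) ((hs i).mul_left (aeval s p))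
    rw [map_mul, aeval_X]
    convert h using 1
    ring

lemma exists_bezout [IsDomain A] (p₁ p₂ : MvPolynomial (Fin 2) A) :
    ∃ B, (X 0 - X 2) * (X 1 - X 3) * B = bezoutNumerator p₁ p₂ := by
  let s : Fin 4 → MvPolynomial (Fin 4) A := ![X 0, X 1, X 0, X 3]
  let t : Fin 4 → MvPolynomial (Fin 4) A := ![X 0, X 1, X 2, X 1]
  have hs : aeval s (bezoutNumerator p₁ p₂) = 0 := by
    simp only [bezoutNumerator, Matrix.det_fin_two_of, map_sub, map_mul, aeval_sub, aeval_X]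
    simp only [s, Matrix.cons_val]
    ring
  have ht : aeval t (bezoutNumerator p₁ p₂) = 0 := by
    simp only [bezoutNumerator, Matrix.det_fin_two_of, map_sub, map_mul, aeval_sub, aeval_X]
    simp only [t, Matrix.cons_val]
    ring
  have hne : (X 0 - X 2 : MvPolynomial (Fin 4) A) ≠ 0 := by
    rw [sub_ne_zero]
    exact fun h => absurd (X_injective h) (by decide)
  have h1 : (X 0 - X 2 : MvPolynomial (Fin 4) A) ∣ bezoutNumerator p₁ p₂ := by
    have h := dvd_sub_aeval (X 0 - X 2) s (by
      intro i
      fin_cases i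
      · simp [s]
      · simp [s]
      · exact ⟨-1, by simp [s]⟩
      · simp [s]) (bezoutNumerator p₁ p₂)
    rwa [hs, sub_zero] at h
  obtain ⟨B, hB⟩ := h1
  have hB0 : aeval t B = 0 := by
    rw [hB, map_mul] at ht
    have hx : aeval t (X 0 - X 2 : MvPolynomial (Fin 4) A) = X 0 - X 2 := by
      simp [t]
    rw [hx] at ht
    exact (mul_eq_zero.mp ht).resolve_left hne
  have h2 : (X 1 - X 3 : MvPolynomial (Fin 4) A) ∣ B := by
    have h := dvd_sub_aeval (X 1 - X 3) t (by
      intro i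
      fin_cases i
      · simp [t]
      · simp [t]
      · simp [t]
      · exact ⟨-1, by simp [t]⟩) B
    rwa [hB0, sub_zero] at h
  obtain ⟨D, hD⟩ := h2
  exact ⟨D, by rw [hB, hD, mul_assoc]⟩

end Four

/-- The polynomial `H((x,y),(z,w))`, one half of the determinant with rows
`((f₁(x,y) - f₁(z,w))/(x - z), (f₂(x,y) - f₂(z,w))/(x - z))` and
`((f₁(z,y) - f₁(x,w))/(y - w), (f₂(z,y) - f₂(x,w))/(y - w))`. It is uniquely determined
by `H_spec`. -/
noncomputable def H (e q : ℕ) : MvPolynomial (Fin 4) (ParamRing e q) :=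
  C (C (1 / 2)) * Classical.choose (exists_bezout (fx e q) (fy e q))

lemma H_spec (e q : ℕ) :
    2 * ((X 0 - X 2) * (X 1 - X 3)) * H e q = bezoutNumerator (fx e q) (fy e q) := by
  rw [← Classical.choose_spec (exists_bezout (fx e q) (fy e q)), H]
  have h : (2 : MvPolynomial (Fin 4) (ParamRing e q)) * C (C (1 / 2)) = 1 := by
    have h2 : (2 : MvPolynomial (Fin 4) (ParamRing e q)) = C (C 2) := by
      rw [map_ofNat (C : ℚ →+* ParamRing e q) 2, map_ofNat]
    rw [h2, ← C_mul, ← C_mul]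
    norm_num
  linear_combination ((X 0 - X 2) * (X 1 - X 3) *
    Classical.choose (exists_bezout (fx e q) (fy e q))) * h

/-- The ideal `(f₁(x,y), f₂(x,y), f₁(z,w), f₂(z,w))` of `ℚ[μ][x,y,z,w]`. -/
noncomputable def jacobianIdeal₂ (e q : ℕ) : Ideal (MvPolynomial (Fin 4) (ParamRing e q)) :=
  Ideal.span {sub (fx e q) (X 0) (X 1), sub (fy e q) (X 0) (X 1),
    sub (fx e q) (X 2) (X 3), sub (fy e q) (X 2) (X 3)}

/-- `V` is the matrix defined by `ᵗM(x,y) V M(z,w) = f(x,y) H((x,y),(z,w))` in the ring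
`ℚ[μ][x,y,z,w] / (f₁(x,y), f₂(x,y), f₁(z,w), f₂(z,w))`. -/
def IsV (e q : ℕ) (V : Matrix (Idx e q) (Idx e q) (ParamRing e q)) : Prop :=
  Ideal.Quotient.mk (jacobianIdeal₂ e q)
      (∑ k, ∑ l, sub (mono _ k) (X 0) (X 1) * C (V k l) * sub (mono _ l) (X 2) (X 3)) =
    Ideal.Quotient.mk (jacobianIdeal₂ e q) (sub (genericPoly e q) (X 0) (X 1) * H e q)

/-- The vector field attached to row `k` of `V`, that is `∑ l, V k l ∂/∂μ_l`. -/
noncomputable def rowField {e q : ℕ} (V : Matrix (Idx e q) (Idx e q) (ParamRing e q))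
    (k : Idx e q) : Derivation ℚ (ParamRing e q) (ParamRing e q) :=
  ∑ l, V k l • pderiv l

/-- `L(D) = ∑ k, M_k(x,y) L_k(D) ∈ ℚ[μ][x,y]`, for `D ∈ ℚ[μ]`. -/
noncomputable def opL {e q : ℕ} (V : Matrix (Idx e q) (Idx e q) (ParamRing e q))
    (D : ParamRing e q) : MvPolynomial (Fin 2) (ParamRing e q) :=
  ∑ k, C (rowField V k D) * mono _ k

/-- A polynomial in the parameters with integer coefficients whose greatest common divisor is `1`
and whose complex zeros are exactly the parameters of the singular curves. -/
def DetectsSingular (e q : ℕ) (D : MvPolynomial (Idx e q) ℤ) : Prop :=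
  (∀ c : ℤ, (∀ m, c ∣ coeff m D) → IsUnit c) ∧
    ∀ μ : Idx e q → ℂ, aeval μ D = 0 ↔ HasSingularPoint μ

/-- The discriminant of the curve: such a polynomial of least degree. -/
def IsDiscriminant (e q : ℕ) (D : MvPolynomial (Idx e q) ℤ) : Prop :=
  DetectsSingular e q D ∧ ∀ D', DetectsSingular e q D' → D.totalDegree ≤ D'.totalDegree

end PlaneTelescopic

/-! Let `J = ℚ[μ][x,y]/(f_x, f_y)`. For the weights `e` of `x` and `q` of `y`, the partial
derivatives have leading terms `x ^ (q-1)` and `y ^ (e-1)` up to constants, so `J` is free over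
`ℚ[μ]` on the monomials `M_k` (`exists_jacBasis`). Let `a` be the matrix of multiplication by `f` on
`J` and `N = det a` (`normPoly`). At a complex parameter, `N` is the product of the critical values
of `f`, so it vanishes exactly when the curve is singular (`det_mulMat_eq_zero_iff`).

The identity is proved for `N`. Modality `0` gives `∂f/∂μ_l = -M_l` for every `l`. Moving the
critical points with the parameters changes `a` only by a commutator, because `f_x = f_y = 0` there;
hence `∂N/∂μ_l = -tr(adj(a) M_l)` (`derivation_det_mulMat`). With `τ(b) = tr(adj(a) b)`, this makes
`-L(N)` the image of `ᵗM V M = f(x,y) H` under `id ⊗ τ`. Now `H` is a Bezoutian, so it is supported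
on the diagonal of `J ⊗ J`: `f(x,y) H = f(z,w) H`, and `τ(f · b) = N · tr(b)`. Finally `id ⊗ tr` of
a tensor supported on the diagonal is its restriction to the diagonal, which for `H` is `Hess f`
(`mk_opL_normPoly`).

It remains to see that the discriminant is a constant multiple of `N`. Shifting the constant
parameter turns `N` into the characteristic polynomial of `a` up to sign; for a suitable special
curve it has `2g` distinct roots, so `N` is squarefree (`squarefree_normPoly`). By the
Nullstellensatz `N` divides every polynomial with the same zeros, and minimality of the degree
leaves a constant quotient (`IsDiscriminant.eq_C_mul_normPoly`). -/

namespace PlaneTelescopic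

/-! ### Weight filtration on `A[x,y]` and leading monomials. -/

section Filtration

variable {A : Type*} [CommRing A]

/-- The polynomials in two variables all of whose monomials `x ^ i y ^ j` have `a i + b j < n`. -/
def lowerWeight (A : Type*) [CommRing A] (a b n : ℕ) : Submodule A (MvPolynomial (Fin 2) A) where
  carrier := {p | ∀ m, coeff m p ≠ 0 → a * m 0 + b * m 1 < n}
  zero_mem' := by simp
  add_mem' := by
    intro p r hp hr m hm
    by_cases h : coeff m p = 0
    · exact hr m (by simpa [h] using hm)
    · exact hp m h
  smul_mem' := by
    intro c p hp m hm
    exact hp m fun h => hm (by simp [h])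

variable {a b : ℕ}

lemma mem_lowerWeight {n : ℕ} {p : MvPolynomial (Fin 2) A} :
    p ∈ lowerWeight A a b n ↔ ∀ m, coeff m p ≠ 0 → a * m 0 + b * m 1 < n := Iff.rfl

lemma lowerWeight_mono {n k : ℕ} (h : n ≤ k) : lowerWeight A a b n ≤ lowerWeight A a b k :=
  fun _ hp m hm => (hp m hm).trans_le h

lemma monomial_mem_lowerWeight {n : ℕ} (m : Fin 2 →₀ ℕ) (c : A) (h : a * m 0 + b * m 1 < n) :
    monomial m c ∈ lowerWeight A a b n := by
  classical
  intro k hk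
  rw [coeff_monomial] at hk
  split_ifs at hk with hmk
  · rwa [← hmk]
  · exact absurd rfl hk

/-- The index `k + 1` encodes weight at most `k`: only one factor has to satisfy a strict bound. -/
lemma mul_mem_lowerWeight {n k : ℕ} {p r : MvPolynomial (Fin 2) A}
    (hp : p ∈ lowerWeight A a b n) (hr : r ∈ lowerWeight A a b (k + 1)) :
    p * r ∈ lowerWeight A a b (n + k) := by
  classical
  intro m hm
  rw [coeff_mul] at hm
  obtain ⟨⟨u, v⟩, huv, hne⟩ := Finset.exists_ne_zero_of_sum_ne_zero hm
  have h1 := hp u (left_ne_zero_of_mul hne)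
  have h2 := hr v (right_ne_zero_of_mul hne)
  rw [Finset.HasAntidiagonal.mem_antidiagonal] at huv
  subst huv
  simp only [Finsupp.add_apply, mul_add]
  omega

/-- `p` is the monomial with exponent `m` up to terms of smaller weight. -/
def HasLeading (a b : ℕ) (m : Fin 2 →₀ ℕ) (p : MvPolynomial (Fin 2) A) : Prop :=
  p - monomial m 1 ∈ lowerWeight A a b (a * m 0 + b * m 1)

lemma HasLeading.mem {m : Fin 2 →₀ ℕ} {p : MvPolynomial (Fin 2) A} (h : HasLeading a b m p) :
    p ∈ lowerWeight A a b (a * m 0 + b * m 1 + 1) := by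
  have h1 := lowerWeight_mono (Nat.le_succ _) h
  have h2 := Submodule.add_mem _ h1 (monomial_mem_lowerWeight m (1 : A) (Nat.lt_succ_self _))
  simpa using h2

lemma HasLeading.mul {m k : Fin 2 →₀ ℕ} {p r : MvPolynomial (Fin 2) A}
    (hp : HasLeading a b m p) (hr : HasLeading a b k r) : HasLeading a b (m + k) (p * r) := by
  have h1 := mul_mem_lowerWeight hp hr.mem
  have h2 := mul_mem_lowerWeight hr
    (monomial_mem_lowerWeight (n := a * m 0 + b * m 1 + 1) m (1 : A) (Nat.lt_succ_self _))
  have h3 : (monomial (m + k) (1 : A) : MvPolynomial (Fin 2) A) = monomial m 1 * monomial k 1 := by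
    simp [monomial_mul]
  have h4 : a * (m + k) 0 + b * (m + k) 1 = a * m 0 + b * m 1 + (a * k 0 + b * k 1) := by
    simp only [Finsupp.add_apply]; ring
  rw [HasLeading, h4, h3]
  rw [add_comm (a * k 0 + b * k 1)] at h2
  convert Submodule.add_mem _ h1 h2 using 1
  ring

lemma HasLeading.one : HasLeading a b 0 (1 : MvPolynomial (Fin 2) A) := by
  rw [HasLeading, ← C_apply, C_1, sub_self]
  exact Submodule.zero_mem _

lemma HasLeading.pow {m : Fin 2 →₀ ℕ} {p : MvPolynomial (Fin 2) A}
    (hp : HasLeading a b m p) (n : ℕ) : HasLeading a b (n • m) (p ^ n) := by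
  induction n with
  | zero => simpa using HasLeading.one
  | succ n ih => rw [pow_succ, succ_nsmul]; exact ih.mul hp

lemma HasLeading.X_pow (i : Fin 2) (n : ℕ) :
    HasLeading a b (Finsupp.single i n) (X i ^ n : MvPolynomial (Fin 2) A) := by
  rw [HasLeading, X_pow_eq_monomial, sub_self]
  exact Submodule.zero_mem _

/-- A linear endomorphism that preserves all leading monomials is bijective. -/
lemma bijective_of_hasLeading (G : MvPolynomial (Fin 2) A →ₗ[A] MvPolynomial (Fin 2) A)
    (hG : ∀ m, HasLeading a b m (G (monomial m 1))) : Function.Bijective G := by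
  -- `G - id` strictly lowers the weight, and the only polynomial of weight below `0` is `0`.
  -- Injectivity and surjectivity both follow by induction on the weight.
  have key : ∀ n, ∀ p ∈ lowerWeight A a b (n + 1), G p - p ∈ lowerWeight A a b n := by
    intro n p hp
    have : G p - p = ∑ m ∈ p.support, coeff m p • (G (monomial m 1) - monomial m 1) := by
      conv_lhs => rw [p.as_sum]
      rw [map_sum, ← Finset.sum_sub_distrib]
      refine Finset.sum_congr rfl fun m _ => ?_
      rw [smul_sub, ← map_smul, smul_monomial, smul_eq_mul, mul_one]
    rw [this]
    refine Submodule.sum_mem _ fun m hm => Submodule.smul_mem _ _ ?_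
    exact lowerWeight_mono (Nat.lt_succ_iff.mp (hp m (mem_support_iff.mp hm))) (hG m)
  have h0 : ∀ p ∈ lowerWeight A a b 0, p = 0 := by
    intro p hp
    ext m
    by_contra h
    exact absurd (hp m h) (Nat.not_lt_zero _)
  have hex : ∀ p : MvPolynomial (Fin 2) A, ∃ n, p ∈ lowerWeight A a b n := by
    intro p
    refine ⟨p.support.sup (fun m => a * m 0 + b * m 1) + 1, fun m hm => Nat.lt_succ_of_le ?_⟩
    exact Finset.le_sup (f := fun m : Fin 2 →₀ ℕ => a * m 0 + b * m 1) (mem_support_iff.mpr hm)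
  constructor
  · rw [← LinearMap.ker_eq_bot, LinearMap.ker_eq_bot']
    have : ∀ n, ∀ p ∈ lowerWeight A a b n, G p = 0 → p = 0 := by
      intro n
      induction n with
      | zero => exact fun p hp _ => h0 p hp
      | succ n ih =>
        intro p hp hGp
        have := key n p hp
        rw [hGp, zero_sub] at this
        exact ih p (by simpa using Submodule.neg_mem _ this) hGp
    intro p hp
    obtain ⟨n, hn⟩ := hex p
    exact this n p hn hp
  · have : ∀ n, ∀ p ∈ lowerWeight A a b n, ∃ r, G r = p := by
      intro n
      induction n with
      | zero => exact fun p hp => ⟨0, by rw [h0 p hp, map_zero]⟩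
      | succ n ih =>
        intro p hp
        obtain ⟨r, hr⟩ := ih _ (key n p hp)
        exact ⟨p - r, by rw [map_sub, hr]; ring⟩
    intro p
    obtain ⟨n, hn⟩ := hex p
    exact this n p hn

end Filtration

/-! ### Monomial bases of quotients by two polynomials with pure-power leading terms. -/

section TriangularBasis

variable {A : Type*} [CommRing A] {a b s t : ℕ} {P Q : MvPolynomial (Fin 2) A}

/-- The linear map sending `x ^ (i + s k) * y ^ (j + t l)` to `x ^ i * y ^ j * P ^ k * Q ^ l`
for `i < s` and `j < t`. -/
noncomputable def triangularMap (s t : ℕ) (P Q : MvPolynomial (Fin 2) A) :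
    MvPolynomial (Fin 2) A →ₗ[A] MvPolynomial (Fin 2) A :=
  (basisMonomials (Fin 2) A).constr A fun m =>
    X 0 ^ (m 0 % s) * P ^ (m 0 / s) * (X 1 ^ (m 1 % t) * Q ^ (m 1 / t))

lemma triangularMap_monomial (m : Fin 2 →₀ ℕ) :
    triangularMap s t P Q (monomial m 1) =
      X 0 ^ (m 0 % s) * P ^ (m 0 / s) * (X 1 ^ (m 1 % t) * Q ^ (m 1 / t)) := by
  have h : (monomial m 1 : MvPolynomial (Fin 2) A) = basisMonomials (Fin 2) A m := by simp
  rw [triangularMap, h, Module.Basis.constr_basis]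

lemma triangularMap_bijective (hP : HasLeading a b (Finsupp.single 0 s) P)
    (hQ : HasLeading a b (Finsupp.single 1 t) Q) :
    Function.Bijective (triangularMap s t P Q) := by
  refine bijective_of_hasLeading (a := a) (b := b) _ fun m => ?_
  rw [triangularMap_monomial]
  have h := ((HasLeading.X_pow 0 (m 0 % s)).mul (hP.pow (m 0 / s))).mul
    ((HasLeading.X_pow 1 (m 1 % t)).mul (hQ.pow (m 1 / t)))
  convert h using 1
  ext i
  fin_cases i
  · simpa [mul_comm] using (Nat.mod_add_div (m 0) s).symm
  · simpa [mul_comm] using (Nat.mod_add_div (m 1) t).symm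

/-- Adding `s` to an exponent keeps its remainder and raises its quotient by one. Although
`triangularMap` is not multiplicative, this rule and its analogue for `y` make it carry the ideal
`(x ^ s, y ^ t)` onto `(P, Q)`, which reduces the quotient to the monomial case. -/
lemma triangularMap_X_zero_pow_mul (hs : 0 < s) (p : MvPolynomial (Fin 2) A) :
    triangularMap s t P Q (X 0 ^ s * p) = P * triangularMap s t P Q p := by
  have : (triangularMap s t P Q) ∘ₗ LinearMap.mulLeft A (X 0 ^ s) =
      LinearMap.mulLeft A P ∘ₗ triangularMap s t P Q := by
    refine (basisMonomials (Fin 2) A).ext fun m => ?_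
    simp only [coe_basisMonomials, LinearMap.comp_apply, LinearMap.mulLeft_apply]
    rw [X_pow_eq_monomial, monomial_mul, one_mul, triangularMap_monomial, triangularMap_monomial]
    simp [Nat.add_div_left _ hs, pow_succ]
    ring
  exact LinearMap.congr_fun this p

lemma triangularMap_X_one_pow_mul (ht : 0 < t) (p : MvPolynomial (Fin 2) A) :
    triangularMap s t P Q (X 1 ^ t * p) = Q * triangularMap s t P Q p := by
  have : (triangularMap s t P Q) ∘ₗ LinearMap.mulLeft A (X 1 ^ t) =
      LinearMap.mulLeft A Q ∘ₗ triangularMap s t P Q := by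
    refine (basisMonomials (Fin 2) A).ext fun m => ?_
    simp only [coe_basisMonomials, LinearMap.comp_apply, LinearMap.mulLeft_apply]
    rw [X_pow_eq_monomial, monomial_mul, one_mul, triangularMap_monomial, triangularMap_monomial]
    simp [Nat.add_div_left _ ht, pow_succ]
    ring
  exact LinearMap.congr_fun this p

/-- The exponent vector of `x ^ i y ^ j`. -/
noncomputable def boxExponent (k : Fin s × Fin t) : Fin 2 →₀ ℕ :=
  Finsupp.single 0 (k.1 : ℕ) + Finsupp.single 1 (k.2 : ℕ)

@[simp] lemma boxExponent_zero (k : Fin s × Fin t) : boxExponent k 0 = k.1 := by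
  simp [boxExponent]

@[simp] lemma boxExponent_one (k : Fin s × Fin t) : boxExponent k 1 = k.2 := by
  simp [boxExponent]

lemma monomial_boxExponent (k : Fin s × Fin t) :
    (monomial (boxExponent k) 1 : MvPolynomial (Fin 2) A) = X 0 ^ (k.1 : ℕ) * X 1 ^ (k.2 : ℕ) := by
  rw [boxExponent, X_pow_eq_monomial, X_pow_eq_monomial, monomial_mul, one_mul]

lemma boxExponent_injective : Function.Injective (boxExponent (s := s) (t := t)) := by
  intro k l h
  have h0 := DFunLike.congr_fun h 0
  have h1 := DFunLike.congr_fun h 1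
  simp only [boxExponent_zero, boxExponent_one] at h0 h1
  exact Prod.ext (Fin.ext h0) (Fin.ext h1)

lemma triangularMap_box (k : Fin s × Fin t) :
    triangularMap s t P Q (monomial (boxExponent k) 1) = X 0 ^ (k.1 : ℕ) * X 1 ^ (k.2 : ℕ) := by
  rw [triangularMap_monomial]
  simp [Nat.mod_eq_of_lt, Nat.div_eq_of_lt]

lemma triangularMap_monomial_mem (m : Fin 2 →₀ ℕ) (hs : 0 < s) (ht : 0 < t)
    (h : ¬ (m 0 < s ∧ m 1 < t)) :
    triangularMap s t P Q (monomial m 1) ∈ Ideal.span {P, Q} := by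
  have hP : P ∈ Ideal.span {P, Q} := Ideal.subset_span (by simp)
  have hQ : Q ∈ Ideal.span {P, Q} := Ideal.subset_span (by simp)
  rw [triangularMap_monomial]
  by_cases h0 : m 0 < s
  · have h1 : m 1 / t ≠ 0 := (Nat.div_pos (not_lt.mp fun h1 => h ⟨h0, h1⟩) ht).ne'
    exact Ideal.mul_mem_left _ _ (Ideal.mul_mem_left _ _ (Ideal.pow_mem_of_mem _ hQ _ h1.bot_lt))
  · have h1 : m 0 / s ≠ 0 := (Nat.div_pos (not_lt.mp h0) hs).ne'
    exact Ideal.mul_mem_right _ _ (Ideal.mul_mem_left _ _ (Ideal.pow_mem_of_mem _ hP _ h1.bot_lt))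

lemma linearIndependent_box (hs : 0 < s) (ht : 0 < t) (hP : HasLeading a b (Finsupp.single 0 s) P)
    (hQ : HasLeading a b (Finsupp.single 1 t) Q) :
    LinearIndependent A fun k : Fin s × Fin t =>
      Ideal.Quotient.mk (Ideal.span {P, Q}) (X 0 ^ (k.1 : ℕ) * X 1 ^ (k.2 : ℕ)) := by
  classical
  obtain ⟨hinj, hsurj⟩ := triangularMap_bijective hP hQ
  rw [Fintype.linearIndependent_iff]
  intro c hc l
  have hmem : ∑ k, c k • (X 0 ^ (k.1 : ℕ) * X 1 ^ (k.2 : ℕ) : MvPolynomial (Fin 2) A) ∈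
      Ideal.span {P, Q} := by
    rw [← Ideal.Quotient.eq_zero_iff_mem, map_sum, ← hc]
    rfl
  -- Pulled back along the bijection, the relation exhibits a combination of box monomials as an
  -- element of `(x ^ s, y ^ t)`, which contains no box monomial; coefficients are then compared.
  obtain ⟨α, β, hαβ⟩ := Ideal.mem_span_pair.mp hmem
  obtain ⟨u, rfl⟩ := hsurj α
  obtain ⟨v, rfl⟩ := hsurj β
  rw [mul_comm _ P, mul_comm _ Q, ← triangularMap_X_zero_pow_mul hs,
    ← triangularMap_X_one_pow_mul ht, ← map_add] at hαβ
  simp only [← triangularMap_box (P := P) (Q := Q)] at hαβ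
  simp only [← map_smul, ← map_sum] at hαβ
  have h := congrArg (coeff (boxExponent l)) (hinj hαβ)
  rw [coeff_add, X_pow_eq_monomial, X_pow_eq_monomial, coeff_monomial_mul', coeff_monomial_mul',
    if_neg, if_neg, coeff_sum] at h
  · simpa [coeff_smul, coeff_monomial, boxExponent_injective.eq_iff] using h.symm
  · simp
  · simp

lemma span_box (hs : 0 < s) (ht : 0 < t) (hP : HasLeading a b (Finsupp.single 0 s) P)
    (hQ : HasLeading a b (Finsupp.single 1 t) Q) :
    ⊤ ≤ Submodule.span A (Set.range fun k : Fin s × Fin t =>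
      Ideal.Quotient.mk (Ideal.span {P, Q}) (X 0 ^ (k.1 : ℕ) * X 1 ^ (k.2 : ℕ))) := by
  rintro x -
  obtain ⟨p, rfl⟩ := Ideal.Quotient.mk_surjective x
  obtain ⟨u, rfl⟩ := (triangularMap_bijective hP hQ).2 p
  rw [u.as_sum, map_sum, map_sum]
  refine Submodule.sum_mem _ fun m _ => ?_
  have hm : (monomial m (coeff m u) : MvPolynomial (Fin 2) A) = coeff m u • monomial m 1 := by
    rw [smul_monomial, smul_eq_mul, mul_one]
  rw [hm, map_smul]
  refine Submodule.smul_mem _ (coeff m u) (x := Ideal.Quotient.mk _ _) ?_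
  by_cases h : m 0 < s ∧ m 1 < t
  · have hk : m = boxExponent (⟨m 0, h.1⟩, ⟨m 1, h.2⟩) := by
      ext i
      fin_cases i <;> simp
    rw [hk, triangularMap_box]
    exact Submodule.subset_span ⟨_, rfl⟩
  · rw [Ideal.Quotient.eq_zero_iff_mem.mpr (triangularMap_monomial_mem m hs ht h)]
    exact Submodule.zero_mem _

end TriangularBasis

/-! ### The ring `A[x,y]/(f_x, f_y)` and its multiplication matrices. -/

section JacobianRing

variable {A : Type*} [CommRing A] {e q : ℕ}

lemma mono_eq_monomial (k : Idx e q) : mono A k = monomial (boxExponent k) 1 :=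
  (monomial_boxExponent k).symm

/-- The ideal of `A[x,y]` generated by the partial derivatives of the defining polynomial. -/
noncomputable def jacIdeal (μ : Idx e q → A) : Ideal (MvPolynomial (Fin 2) A) :=
  Ideal.span {pderiv 0 (curvePoly μ), pderiv 1 (curvePoly μ)}

lemma pderiv_zero_mem_jacIdeal (μ : Idx e q → A) : pderiv 0 (curvePoly μ) ∈ jacIdeal μ :=
  Ideal.subset_span (by simp)

lemma pderiv_one_mem_jacIdeal (μ : Idx e q → A) : pderiv 1 (curvePoly μ) ∈ jacIdeal μ :=
  Ideal.subset_span (by simp)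

lemma pderiv_curvePoly (μ : Idx e q → A) (i : Fin 2) :
    pderiv i (curvePoly μ) = pderiv i (X 1 ^ e) - pderiv i (X 0 ^ q) -
      ∑ k ∈ weierstrassSupport e q, C (μ k) * pderiv i (mono A k) := by
  simp only [curvePoly, map_sub, map_sum, pderiv_C_mul]

lemma weight_lt_of_mem_support {k : Idx e q} (hk : k ∈ weierstrassSupport e q) :
    e * (k.1 : ℕ) + q * (k.2 : ℕ) < e * q := by
  simpa [weierstrassSupport] using hk

lemma pderiv_zero_mono_mem {k : Idx e q} (hk : k ∈ weierstrassSupport e q) :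
    pderiv 0 (mono A k) ∈ lowerWeight A e q (e * (q - 1)) := by
  rw [mono_eq_monomial, pderiv_monomial]
  have h := weight_lt_of_mem_support hk
  by_cases h0 : (k.1 : ℕ) = 0
  · simp [h0]
  · refine monomial_mem_lowerWeight _ _ ?_
    simp only [Finsupp.tsub_apply, boxExponent_zero, boxExponent_one, Finsupp.single_eq_same]
    rw [Finsupp.single_eq_of_ne (by decide), Nat.sub_zero]
    obtain ⟨n, hn⟩ := Nat.exists_eq_succ_of_ne_zero h0
    have hq : 0 < q := by have := k.1.2; omega
    obtain ⟨m, rfl⟩ := Nat.exists_eq_succ_of_ne_zero hq.ne'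
    rw [hn] at h ⊢
    simp only [Nat.succ_eq_add_one, Nat.add_sub_cancel, mul_add, mul_one, add_mul, one_mul] at h ⊢
    omega

lemma pderiv_one_mono_mem {k : Idx e q} (hk : k ∈ weierstrassSupport e q) :
    pderiv 1 (mono A k) ∈ lowerWeight A e q (q * (e - 1)) := by
  rw [mono_eq_monomial, pderiv_monomial]
  have h := weight_lt_of_mem_support hk
  by_cases h0 : (k.2 : ℕ) = 0
  · simp [h0]
  · refine monomial_mem_lowerWeight _ _ ?_
    simp only [Finsupp.tsub_apply, boxExponent_zero, boxExponent_one, Finsupp.single_eq_same]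
    rw [Finsupp.single_eq_of_ne (by decide), Nat.sub_zero]
    obtain ⟨n, hn⟩ := Nat.exists_eq_succ_of_ne_zero h0
    have he : 0 < e := by have := k.2.2; omega
    obtain ⟨m, rfl⟩ := Nat.exists_eq_succ_of_ne_zero he.ne'
    rw [hn] at h ⊢
    simp only [Nat.succ_eq_add_one, Nat.add_sub_cancel, mul_add, mul_one, add_mul, one_mul] at h ⊢
    rw [mul_comm q m]
    omega

lemma map_curvePoly {B : Type*} [CommRing B] (φ : A →+* B) (μ : Idx e q → A) :
    map φ (curvePoly μ) = curvePoly (φ ∘ μ) := by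
  simp [curvePoly, mono]

lemma map_mem_jacIdeal {B : Type*} [CommRing B] (φ : A →+* B) {μ : Idx e q → A}
    {p : MvPolynomial (Fin 2) A} (hp : p ∈ jacIdeal μ) : map φ p ∈ jacIdeal (φ ∘ μ) := by
  obtain ⟨α, β, rfl⟩ := Ideal.mem_span_pair.mp hp
  rw [map_add, map_mul, map_mul, ← pderiv_map, ← pderiv_map, map_curvePoly]
  exact Ideal.add_mem _ (Ideal.mul_mem_left _ _ (pderiv_zero_mem_jacIdeal _))
    (Ideal.mul_mem_left _ _ (pderiv_one_mem_jacIdeal _))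

variable [Algebra ℚ A]

lemma algebraMap_inv_mul_natCast {n : ℕ} (hn : n ≠ 0) :
    algebraMap ℚ A (n : ℚ)⁻¹ * (n : A) = 1 := by
  rw [← map_natCast (algebraMap ℚ A) n, ← map_mul, inv_mul_cancel₀ (Nat.cast_ne_zero.mpr hn),
    map_one]

lemma hasLeading_pderiv_zero (hq : 2 ≤ q) (μ : Idx e q → A) :
    HasLeading e q (Finsupp.single 0 (q - 1))
      (C (algebraMap ℚ A (q : ℚ)⁻¹) * -pderiv 0 (curvePoly μ)) := by
  have hu := congrArg (C (σ := Fin 2)) (algebraMap_inv_mul_natCast (A := A) (n := q) (by omega))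
  rw [C_mul, C_1, map_natCast] at hu
  have h : C (algebraMap ℚ A (q : ℚ)⁻¹) * -pderiv 0 (curvePoly μ) -
      monomial (Finsupp.single 0 (q - 1)) 1 = ∑ k ∈ weierstrassSupport e q,
        (algebraMap ℚ A (q : ℚ)⁻¹ * μ k) • pderiv 0 (mono A k) := by
    rw [pderiv_curvePoly, ← X_pow_eq_monomial]
    simp only [smul_eq_C_mul, C_mul, mul_assoc, ← Finset.mul_sum]
    rw [pderiv_pow, pderiv_pow, pderiv_X_self, pderiv_X_of_ne (by decide)]
    linear_combination (X 0 ^ (q - 1)) * hu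
  rw [HasLeading, h]
  refine Submodule.sum_mem _ fun k hk => Submodule.smul_mem _ _ ?_
  simpa using pderiv_zero_mono_mem hk

lemma hasLeading_pderiv_one (he : 2 ≤ e) (μ : Idx e q → A) :
    HasLeading e q (Finsupp.single 1 (e - 1))
      (C (algebraMap ℚ A (e : ℚ)⁻¹) * pderiv 1 (curvePoly μ)) := by
  have hu := congrArg (C (σ := Fin 2)) (algebraMap_inv_mul_natCast (A := A) (n := e) (by omega))
  rw [C_mul, C_1, map_natCast] at hu
  have h : C (algebraMap ℚ A (e : ℚ)⁻¹) * pderiv 1 (curvePoly μ) -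
      monomial (Finsupp.single 1 (e - 1)) 1 = ∑ k ∈ weierstrassSupport e q,
        (-(algebraMap ℚ A (e : ℚ)⁻¹ * μ k)) • pderiv 1 (mono A k) := by
    rw [pderiv_curvePoly, ← X_pow_eq_monomial]
    simp only [smul_eq_C_mul, C_mul, C_neg, neg_mul, mul_assoc, ← Finset.mul_sum,
      Finset.sum_neg_distrib]
    rw [pderiv_pow, pderiv_pow, pderiv_X_self, pderiv_X_of_ne (by decide)]
    linear_combination (X 1 ^ (e - 1)) * hu
  rw [HasLeading, h]
  refine Submodule.sum_mem _ fun k hk => Submodule.smul_mem _ _ ?_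
  simpa using pderiv_one_mono_mem hk

lemma jacIdeal_eq_span (he : 2 ≤ e) (hq : 2 ≤ q) (μ : Idx e q → A) :
    jacIdeal μ = Ideal.span {C (algebraMap ℚ A (q : ℚ)⁻¹) * -pderiv 0 (curvePoly μ),
      C (algebraMap ℚ A (e : ℚ)⁻¹) * pderiv 1 (curvePoly μ)} := by
  have hu := congrArg (C (σ := Fin 2)) (algebraMap_inv_mul_natCast (A := A) (n := q) (by omega))
  have hv := congrArg (C (σ := Fin 2)) (algebraMap_inv_mul_natCast (A := A) (n := e) (by omega))
  rw [C_mul, C_1] at hu hv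
  apply le_antisymm
  · rw [jacIdeal, Ideal.span_le, Set.insert_subset_iff, Set.singleton_subset_iff]
    constructor
    · refine Ideal.mem_span_pair.mpr ⟨-C (q : A), 0, ?_⟩
      linear_combination (pderiv 0 (curvePoly μ)) * hu
    · refine Ideal.mem_span_pair.mpr ⟨0, C (e : A), ?_⟩
      linear_combination (pderiv 1 (curvePoly μ)) * hv
  · rw [Ideal.span_le, Set.insert_subset_iff, Set.singleton_subset_iff]
    exact ⟨Ideal.mul_mem_left _ _ (neg_mem (pderiv_zero_mem_jacIdeal μ)),
      Ideal.mul_mem_left _ _ (pderiv_one_mem_jacIdeal μ)⟩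

/-- The monomials `x ^ i y ^ j` with `i ≤ q - 2` and `j ≤ e - 2` form a basis of
`A[x,y] / (f_x, f_y)`. -/
lemma exists_jacBasis (he : 2 ≤ e) (hq : 2 ≤ q) (μ : Idx e q → A) :
    ∃ b : Module.Basis (Idx e q) A (MvPolynomial (Fin 2) A ⧸ jacIdeal μ),
      ∀ k, b k = Ideal.Quotient.mk _ (mono A k) := by
  have hP := hasLeading_pderiv_zero hq μ
  have hQ := hasLeading_pderiv_one he μ
  have hs : 0 < q - 1 := by omega
  have ht : 0 < e - 1 := by omega
  rw [jacIdeal_eq_span he hq]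
  exact ⟨Module.Basis.mk (linearIndependent_box hs ht hP hQ) (span_box hs ht hP hQ),
    fun k => by rw [Module.Basis.mk_apply]; rfl⟩

/-- The monomial basis of `A[x,y] / (f_x, f_y)`. -/
noncomputable def jacBasis (he : 2 ≤ e) (hq : 2 ≤ q) (μ : Idx e q → A) :
    Module.Basis (Idx e q) A (MvPolynomial (Fin 2) A ⧸ jacIdeal μ) :=
  (exists_jacBasis he hq μ).choose

lemma jacBasis_apply (he : 2 ≤ e) (hq : 2 ≤ q) (μ : Idx e q → A) (k : Idx e q) :
    jacBasis he hq μ k = Ideal.Quotient.mk _ (mono A k) :=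
  (exists_jacBasis he hq μ).choose_spec k

/-- The matrix of the multiplication by a polynomial on `A[x,y] / (f_x, f_y)`. -/
noncomputable def mulMat (he : 2 ≤ e) (hq : 2 ≤ q) (μ : Idx e q → A) :
    MvPolynomial (Fin 2) A →ₐ[A] Matrix (Idx e q) (Idx e q) A :=
  (Algebra.leftMulMatrix (jacBasis he hq μ)).comp (Ideal.Quotient.mkₐ A (jacIdeal μ))

variable (he : 2 ≤ e) (hq : 2 ≤ q) (μ : Idx e q → A)

lemma mulMat_apply (p : MvPolynomial (Fin 2) A) (j k : Idx e q) :
    mulMat he hq μ p j k =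
      (jacBasis he hq μ).repr (Ideal.Quotient.mk _ p * Ideal.Quotient.mk _ (mono A k)) j := by
  rw [mulMat, AlgHom.comp_apply, Algebra.leftMulMatrix_eq_repr_mul, jacBasis_apply]
  rfl

lemma sum_mk_C_mul_mono (c : Idx e q → A) :
    Ideal.Quotient.mk (jacIdeal μ) (∑ j, C (c j) * mono A j) = ∑ j, c j • jacBasis he hq μ j := by
  rw [map_sum]
  refine Finset.sum_congr rfl fun j _ => ?_
  rw [jacBasis_apply, ← smul_eq_C_mul]
  rfl

lemma mulMat_spec (p : MvPolynomial (Fin 2) A) (k : Idx e q) :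
    p * mono A k - ∑ j, C (mulMat he hq μ p j k) * mono A j ∈ jacIdeal μ := by
  rw [← Ideal.Quotient.eq, sum_mk_C_mul_mono he hq, map_mul]
  simp only [mulMat_apply]
  exact ((jacBasis he hq μ).sum_repr _).symm

lemma mulMat_eq {p : MvPolynomial (Fin 2) A} {a : Matrix (Idx e q) (Idx e q) A}
    (h : ∀ k, p * mono A k - ∑ j, C (a j k) * mono A j ∈ jacIdeal μ) : mulMat he hq μ p = a := by
  ext j k
  have hk := h k
  rw [← Ideal.Quotient.eq, sum_mk_C_mul_mono he hq, map_mul] at hk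
  rw [mulMat_apply, hk, Module.Basis.repr_sum_self]

/-- The monomial basis is the same over every base, so multiplication matrices commute with base
change. This is what permits specialising the parameters. -/
lemma mulMat_map {B : Type*} [CommRing B] [Algebra ℚ B] (φ : A →+* B)
    (p : MvPolynomial (Fin 2) A) :
    mulMat he hq (φ ∘ μ) (map φ p) = (mulMat he hq μ p).map φ := by
  refine mulMat_eq he hq _ fun k => ?_
  have h := map_mem_jacIdeal φ (mulMat_spec he hq μ p k)
  simpa [mono] using h

lemma mulMat_congr {μ μ' : Idx e q → A} (h : jacIdeal μ = jacIdeal μ')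
    (p : MvPolynomial (Fin 2) A) : mulMat he hq μ p = mulMat he hq μ' p :=
  mulMat_eq he hq _ fun k => h ▸ mulMat_spec he hq μ' p k

end JacobianRing

/-! ### Vanishing of a norm and common zeros. -/

section CommonZeros

variable {e q : ℕ} (he : 2 ≤ e) (hq : 2 ≤ q)

/-- The index of the constant monomial. -/
def zeroIdx : Idx e q := (⟨0, by omega⟩, ⟨0, by omega⟩)

lemma mono_zeroIdx {A : Type*} [CommRing A] : mono A (zeroIdx he hq) = 1 := by
  simp [mono, zeroIdx]

/-- Without a common zero, the Nullstellensatz makes `p` invertible modulo `(f_x, f_y)`, hence its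
matrix too. Conversely, the values of the monomials at a common zero form a left null vector,
nonzero because the monomial `1` is among them. -/
lemma det_mulMat_eq_zero_iff {K : Type*} [Field K] [IsAlgClosed K] [Algebra ℚ K]
    (ν : Idx e q → K) (p : MvPolynomial (Fin 2) K) :
    (mulMat he hq ν p).det = 0 ↔ ∃ P : Fin 2 → K, eval P p = 0 ∧
      eval P (pderiv 0 (curvePoly ν)) = 0 ∧ eval P (pderiv 1 (curvePoly ν)) = 0 := by
  constructor
  · intro hdet
    by_contra hP
    push Not at hP
    have hz : zeroLocus K (Ideal.span {p} ⊔ jacIdeal ν) = ∅ := by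
      rw [Set.eq_empty_iff_forall_notMem]
      intro P h
      rw [mem_zeroLocus_iff] at h
      refine hP P ?_ ?_ ?_
      · simpa using h p (Ideal.mem_sup_left (Ideal.mem_span_singleton_self p))
      · simpa using h _ (Ideal.mem_sup_right (pderiv_zero_mem_jacIdeal ν))
      · simpa using h _ (Ideal.mem_sup_right (pderiv_one_mem_jacIdeal ν))
    have htop := vanishingIdeal_zeroLocus_eq_radical (K := K) (Ideal.span {p} ⊔ jacIdeal ν)
    rw [hz, vanishingIdeal_empty, eq_comm, Ideal.radical_eq_top, Ideal.eq_top_iff_one] at htop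
    obtain ⟨u, hu, v, hv, huv⟩ := Submodule.mem_sup.mp htop
    obtain ⟨w, rfl⟩ := Ideal.mem_span_singleton'.mp hu
    have h1 : mulMat he hq ν (w * p) = 1 := by
      refine mulMat_eq he hq ν fun k => ?_
      have h2 : ∑ j, C ((1 : Matrix (Idx e q) (Idx e q) K) j k) * mono K j = mono K k := by
        simp [Matrix.one_apply]
      rw [h2]
      have h3 : w * p * mono K k - mono K k = -(mono K k) * v := by
        linear_combination (mono K k) * huv
      rw [h3]
      exact Ideal.mul_mem_left _ _ hv
    have h4 := congrArg Matrix.det h1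
    rw [map_mul, Matrix.det_mul, hdet, mul_zero, Matrix.det_one] at h4
    exact zero_ne_one h4
  · rintro ⟨P, hp, h0, h1⟩
    rw [← Matrix.exists_vecMul_eq_zero_iff]
    refine ⟨fun j => eval P (mono K j), fun h => ?_, ?_⟩
    · have := congrFun h (zeroIdx he hq)
      simp [mono_zeroIdx] at this
    · ext k
      obtain ⟨α, β, hαβ⟩ := Ideal.mem_span_pair.mp (mulMat_spec he hq ν p k)
      have h := congrArg (eval P) hαβ
      simp only [map_add, map_mul, map_sub, map_sum, h0, h1, hp, eval_C, mul_zero, zero_mul,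
        add_zero, zero_sub] at h
      simp only [Matrix.vecMul, dotProduct, Pi.zero_apply]
      rw [eq_comm, neg_eq_zero] at h
      rw [← h]
      exact Finset.sum_congr rfl fun j _ => mul_comm _ _

end CommonZeros

/-! ### Jacobi's formula. -/

section Jacobi

variable {R : Type*} [CommRing R] [Algebra ℚ R] (δ : Derivation ℚ R R)

lemma derivation_prod {ι : Type*} [DecidableEq ι] (s : Finset ι) (g : ι → R) :
    δ (∏ i ∈ s, g i) = ∑ i ∈ s, (∏ j ∈ s.erase i, g j) * δ (g i) := by
  induction s using Finset.induction_on with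
  | empty => simp
  | insert a s ha ih =>
    rw [Finset.prod_insert ha, Finset.sum_insert ha, Finset.erase_insert ha, δ.leibniz, ih,
      smul_eq_mul, smul_eq_mul, Finset.mul_sum, add_comm]
    congr 1
    refine Finset.sum_congr rfl fun i hi => ?_
    have hai : a ≠ i := fun h => ha (h ▸ hi)
    rw [Finset.erase_insert_of_ne hai, Finset.prod_insert (fun h => ha (Finset.mem_of_mem_erase h)),
      mul_assoc]

/-- Jacobi's formula for the derivative of a determinant. -/
lemma derivation_det {n : Type*} [Fintype n] [DecidableEq n] (a : Matrix n n R) :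
    δ a.det = (a.adjugate * a.map δ).trace := by
  have h : ∀ i, (a.adjugate * a.map δ) i i = ∑ σ : Equiv.Perm n,
      Equiv.Perm.sign σ • ((∏ j ∈ Finset.univ.erase i, a (σ j) j) * δ (a (σ i) i)) := by
    intro i
    have h1 : (a.adjugate * a.map δ) i i = (a.updateCol i fun j => δ (a j i)).det := by
      rw [← Matrix.cramer_apply, Matrix.cramer_eq_adjugate_mulVec]
      rfl
    rw [h1, Matrix.det_apply]
    refine Finset.sum_congr rfl fun σ _ => ?_
    rw [← Finset.prod_erase_mul _ _ (Finset.mem_univ i), Matrix.updateCol_self]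
    congr 2
    refine Finset.prod_congr rfl fun j hj => ?_
    rw [Matrix.updateCol_ne (Finset.ne_of_mem_erase hj)]
  rw [Matrix.trace, Matrix.det_apply, map_sum]
  simp only [Matrix.diag_apply, h]
  rw [Finset.sum_comm]
  refine Finset.sum_congr rfl fun σ _ => ?_
  rw [← Finset.smul_sum, ← derivation_prod]
  rcases Int.units_eq_one_or (Equiv.Perm.sign σ) with h | h <;> simp [h]

end Jacobi

/-! ### Derivations acting on coefficients. -/

section CoeffDerivation

variable {R : Type*} [CommRing R] [Algebra ℚ R] (δ : Derivation ℚ R R)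

/-- A derivation of the coefficient ring applied to all coefficients of a polynomial. -/
noncomputable def coeffDerivation (p : MvPolynomial (Fin 2) R) : MvPolynomial (Fin 2) R :=
  ∑ m ∈ p.support, monomial m (δ (coeff m p))

lemma coeff_coeffDerivation (p : MvPolynomial (Fin 2) R) (m : Fin 2 →₀ ℕ) :
    coeff m (coeffDerivation δ p) = δ (coeff m p) := by
  classical
  rw [coeffDerivation, coeff_sum]
  simp only [coeff_monomial]
  rw [Finset.sum_ite_eq']
  split_ifs with h
  · rfl
  · rw [notMem_support_iff.mp h, map_zero]

lemma coeffDerivation_add (p r : MvPolynomial (Fin 2) R) :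
    coeffDerivation δ (p + r) = coeffDerivation δ p + coeffDerivation δ r := by
  ext m
  simp [coeff_coeffDerivation]

lemma coeffDerivation_sub (p r : MvPolynomial (Fin 2) R) :
    coeffDerivation δ (p - r) = coeffDerivation δ p - coeffDerivation δ r := by
  ext m
  simp [coeff_coeffDerivation]

lemma coeffDerivation_sum {ι : Type*} (s : Finset ι) (p : ι → MvPolynomial (Fin 2) R) :
    coeffDerivation δ (∑ i ∈ s, p i) = ∑ i ∈ s, coeffDerivation δ (p i) := by
  ext m
  simp [coeff_coeffDerivation, coeff_sum]

lemma coeffDerivation_mul (p r : MvPolynomial (Fin 2) R) :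
    coeffDerivation δ (p * r) = p * coeffDerivation δ r + coeffDerivation δ p * r := by
  classical
  ext m
  rw [coeff_coeffDerivation, coeff_add, coeff_mul, coeff_mul, coeff_mul, map_sum,
    ← Finset.sum_add_distrib]
  refine Finset.sum_congr rfl fun x _ => ?_
  rw [δ.leibniz, smul_eq_mul, smul_eq_mul, coeff_coeffDerivation, coeff_coeffDerivation]
  ring

lemma coeffDerivation_monomial (m : Fin 2 →₀ ℕ) (c : R) :
    coeffDerivation δ (monomial m c) = monomial m (δ c) := by
  classical
  ext k
  rw [coeff_coeffDerivation, coeff_monomial, coeff_monomial]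
  split_ifs <;> simp

lemma coeffDerivation_pderiv (p : MvPolynomial (Fin 2) R) (i : Fin 2) :
    coeffDerivation δ (pderiv i p) = pderiv i (coeffDerivation δ p) := by
  induction p using MvPolynomial.induction_on' with
  | monomial m c =>
    rw [pderiv_monomial, coeffDerivation_monomial, coeffDerivation_monomial, pderiv_monomial,
      δ.leibniz, Derivation.map_natCast, smul_zero, zero_add, smul_eq_mul, mul_comm]
  | add p r hp hr => rw [map_add, coeffDerivation_add, hp, hr, coeffDerivation_add, map_add]

lemma coeffDerivation_C (c : R) : coeffDerivation δ (C c) = C (δ c) := by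
  rw [C_apply, coeffDerivation_monomial, C_apply]

lemma coeffDerivation_mono {e q : ℕ} (k : Idx e q) : coeffDerivation δ (mono R k) = 0 := by
  rw [mono_eq_monomial, coeffDerivation_monomial, Derivation.map_one_eq_zero, map_zero]

lemma coeffDerivation_curvePoly {e q : ℕ} (μ : Idx e q → R) :
    coeffDerivation δ (curvePoly μ) =
      -∑ k ∈ weierstrassSupport e q, C (δ (μ k)) * mono R k := by
  have h : ∀ (i : Fin 2) (n : ℕ), coeffDerivation δ (X i ^ n : MvPolynomial (Fin 2) R) = 0 := by
    intro i n
    rw [X_pow_eq_monomial, coeffDerivation_monomial, Derivation.map_one_eq_zero, map_zero]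
  simp only [curvePoly, coeffDerivation_sub, h, coeffDerivation_sum, coeffDerivation_mul,
    coeffDerivation_C, coeffDerivation_mono]
  simp

end CoeffDerivation

/-! ### Matrices read as families of elements of the Jacobian ring. -/

section ColumnPolynomials

variable {R : Type*} [CommRing R] {e q : ℕ}

/-- The polynomial whose coefficients in the monomials `x ^ i y ^ j` are the entries of a column. -/
noncomputable def colPoly (a : Matrix (Idx e q) (Idx e q) R) (k : Idx e q) :
    MvPolynomial (Fin 2) R :=
  ∑ j, C (a j k) * mono R j

lemma colPoly_mul (a b : Matrix (Idx e q) (Idx e q) R) (k : Idx e q) :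
    colPoly (a * b) k = ∑ j, C (b j k) * colPoly a j := by
  simp only [colPoly, Matrix.mul_apply, map_sum, Finset.sum_mul, Finset.mul_sum]
  rw [Finset.sum_comm]
  refine Finset.sum_congr rfl fun i _ => Finset.sum_congr rfl fun j _ => ?_
  rw [C_mul]
  ring

lemma colPoly_add (a b : Matrix (Idx e q) (Idx e q) R) (k : Idx e q) :
    colPoly (a + b) k = colPoly a k + colPoly b k := by
  simp [colPoly, add_mul, Finset.sum_add_distrib]

lemma colPoly_sub (a b : Matrix (Idx e q) (Idx e q) R) (k : Idx e q) :
    colPoly (a - b) k = colPoly a k - colPoly b k := by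
  simp [colPoly, sub_mul, Finset.sum_sub_distrib]

variable [Algebra ℚ R]

lemma mk_colPoly_mulMat (he : 2 ≤ e) (hq : 2 ≤ q) (μ : Idx e q → R) (p : MvPolynomial (Fin 2) R) (k : Idx e q) :
    Ideal.Quotient.mk (jacIdeal μ) (colPoly (mulMat he hq μ p) k) =
      Ideal.Quotient.mk (jacIdeal μ) (p * mono R k) :=
  (Ideal.Quotient.eq.mpr (mulMat_spec he hq μ p k)).symm

lemma mk_colPoly_mulMat_mul (he : 2 ≤ e) (hq : 2 ≤ q) (μ : Idx e q → R)
    (p : MvPolynomial (Fin 2) R) (a : Matrix (Idx e q) (Idx e q) R)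
    (k : Idx e q) :
    Ideal.Quotient.mk (jacIdeal μ) (colPoly (mulMat he hq μ p * a) k) =
      Ideal.Quotient.mk (jacIdeal μ) (p * colPoly a k) := by
  rw [colPoly_mul, colPoly, Finset.mul_sum, map_sum, map_sum]
  refine Finset.sum_congr rfl fun j _ => ?_
  rw [map_mul, mk_colPoly_mulMat, ← map_mul]
  congr 1
  ring

lemma eq_of_mk_colPoly_eq (he : 2 ≤ e) (hq : 2 ≤ q) (μ : Idx e q → R)
    {a b : Matrix (Idx e q) (Idx e q) R}
    (h : ∀ k, Ideal.Quotient.mk (jacIdeal μ) (colPoly a k) =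
      Ideal.Quotient.mk (jacIdeal μ) (colPoly b k)) : a = b := by
  ext j k
  have hk := congrArg (fun x => (jacBasis he hq μ).repr x j) (h k)
  simpa only [colPoly, sum_mk_C_mul_mono he hq, Module.Basis.repr_sum_self] using hk

lemma exists_mk_colPoly_eq (he : 2 ≤ e) (hq : 2 ≤ q) (μ : Idx e q → R)
    (p : Idx e q → MvPolynomial (Fin 2) R) :
    ∃ t : Matrix (Idx e q) (Idx e q) R, ∀ k,
      Ideal.Quotient.mk (jacIdeal μ) (colPoly t k) = Ideal.Quotient.mk (jacIdeal μ) (p k) := by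
  refine ⟨fun j k => (jacBasis he hq μ).repr (Ideal.Quotient.mk _ (p k)) j, fun k => ?_⟩
  unfold colPoly
  rw [sum_mk_C_mul_mono he hq, Module.Basis.sum_repr]

end ColumnPolynomials

/-! ### Differentiating the norm of `f` in the parameters. -/

section DetDerivative

variable {R : Type*} [CommRing R] [Algebra ℚ R] (δ : Derivation ℚ R R)
  {e q : ℕ} (he : 2 ≤ e) (hq : 2 ≤ q) (μ : Idx e q → R)

/-- Differentiating the multiplication matrix of `f`: up to a commutator, it is the multiplication
matrix of the derivative of `f` with respect to the parameters. -/
lemma mulMat_hess_mul (g : MvPolynomial (Fin 2) R) (hg : coeffDerivation δ (curvePoly μ) = -g) :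
    ∃ t : Matrix (Idx e q) (Idx e q) R,
      mulMat he hq μ (hess (curvePoly μ)) *
          ((mulMat he hq μ (curvePoly μ)).map δ + mulMat he hq μ g) =
        mulMat he hq μ (curvePoly μ) * t - t * mulMat he hq μ (curvePoly μ) := by
  set f := curvePoly μ with hf
  set a := mulMat he hq μ f with ha
  have hmk0 : Ideal.Quotient.mk (jacIdeal μ) (pderiv 0 f) = 0 :=
    Ideal.Quotient.eq_zero_iff_mem.mpr (pderiv_zero_mem_jacIdeal μ)
  have hmk1 : Ideal.Quotient.mk (jacIdeal μ) (pderiv 1 f) = 0 :=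
    Ideal.Quotient.eq_zero_iff_mem.mpr (pderiv_one_mem_jacIdeal μ)
  have hrel : ∀ k, ∃ α β, α * pderiv 0 f + β * pderiv 1 f =
      f * mono R k - ∑ j, C (a j k) * mono R j :=
    fun k => Ideal.mem_span_pair.mp (mulMat_spec he hq μ f k)
  -- Keeping `f_x = f_y = 0` under `δ` forces velocities `x', y'` with `f_xx x' + f_xy y' = g_x` and
  -- `f_yx x' + f_yy y' = g_y`. By Cramer's rule, `T k` is `Hess f · (x' ∂_x + y' ∂_y)` applied to
  -- `M_k`; the Hessian factor avoids division.
  let T : Idx e q → MvPolynomial (Fin 2) R := fun k =>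
    (pderiv 1 (pderiv 1 f) * pderiv 0 (mono R k) -
        pderiv 0 (pderiv 1 f) * pderiv 1 (mono R k)) * pderiv 0 g +
      (pderiv 0 (pderiv 0 f) * pderiv 1 (mono R k) -
        pderiv 1 (pderiv 0 f) * pderiv 0 (mono R k)) * pderiv 1 g
  obtain ⟨t, ht⟩ := exists_mk_colPoly_eq he hq μ T
  refine ⟨t, eq_of_mk_colPoly_eq he hq μ fun k => ?_⟩
  obtain ⟨α, β, hαβ⟩ := hrel k
  have hδ := congrArg (fun p => Ideal.Quotient.mk (jacIdeal μ) (coeffDerivation δ p)) hαβ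
  have hx := congrArg (fun p => Ideal.Quotient.mk (jacIdeal μ) (pderiv 0 p)) hαβ
  have hy := congrArg (fun p => Ideal.Quotient.mk (jacIdeal μ) (pderiv 1 p)) hαβ
  simp only [coeffDerivation_add, coeffDerivation_sub, coeffDerivation_mul, coeffDerivation_sum,
    coeffDerivation_C, coeffDerivation_mono, coeffDerivation_pderiv, hg, map_add, map_sub,
    map_mul, map_neg, hmk0, map_sum, hmk1, mul_zero,
    add_zero, zero_add] at hδ
  simp only [map_add, map_sub, map_sum, Derivation.leibniz, smul_eq_mul, pderiv_C, mul_zero,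
    add_zero, map_mul, hmk0, hmk1] at hx hy
  have hcol : Ideal.Quotient.mk (jacIdeal μ) (colPoly (t * a) k) =
      ∑ j, Ideal.Quotient.mk (jacIdeal μ) (C (a j k)) * Ideal.Quotient.mk (jacIdeal μ) (T j) := by
    rw [colPoly_mul, map_sum]
    exact Finset.sum_congr rfl fun j _ => by rw [map_mul, ht]
  have hT : ∑ j, Ideal.Quotient.mk (jacIdeal μ) (C (a j k)) *
      Ideal.Quotient.mk (jacIdeal μ) (T j) = Ideal.Quotient.mk (jacIdeal μ)
      ((pderiv 1 (pderiv 1 f) * (∑ j, C (a j k) * pderiv 0 (mono R j)) -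
        pderiv 0 (pderiv 1 f) * ∑ j, C (a j k) * pderiv 1 (mono R j)) * pderiv 0 g +
      (pderiv 0 (pderiv 0 f) * (∑ j, C (a j k) * pderiv 1 (mono R j)) -
        pderiv 1 (pderiv 0 f) * ∑ j, C (a j k) * pderiv 0 (mono R j)) * pderiv 1 g) := by
    simp only [Finset.mul_sum, ← Finset.sum_sub_distrib, Finset.sum_mul, ← Finset.sum_add_distrib]
    rw [map_sum]
    refine Finset.sum_congr rfl fun j _ => ?_
    rw [← map_mul]
    congr 1
    ring
  have hmap : colPoly (a.map δ) k = ∑ j, C (δ (a j k)) * mono R j := rfl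
  rw [mk_colPoly_mulMat_mul, colPoly_sub, map_sub, ha, mk_colPoly_mulMat_mul, ← ha, hcol, hT,
    map_mul, map_mul, ht, colPoly_add, map_add, mk_colPoly_mulMat, hmap]
  simp only [T, hess, Matrix.det_fin_two_of, map_add, map_sub, map_mul, map_sum]
  -- The relation for `f M_k` is differentiated by `δ`, `∂_x` and `∂_y`. The last two express the
  -- second-derivative terms carrying the unknown `α, β`, and Cramer's rule eliminates these.
  set π := Ideal.Quotient.mk (jacIdeal μ)
  linear_combination ((π (pderiv 0 (pderiv 0 f)) * π (pderiv 1 (pderiv 1 f)) -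
      π (pderiv 0 (pderiv 1 f)) * π (pderiv 1 (pderiv 0 f)))) * hδ +
    (π (pderiv 1 (pderiv 1 f)) * π (pderiv 0 g) - π (pderiv 1 (pderiv 0 f)) * π (pderiv 1 g)) * hx +
    (π (pderiv 0 (pderiv 0 f)) * π (pderiv 1 g) - π (pderiv 0 (pderiv 1 f)) * π (pderiv 0 g)) * hy

/-- The derivative of the norm of `f` with respect to the parameters. -/
lemma derivation_det_mulMat [IsDomain R] (g : MvPolynomial (Fin 2) R)
    (hg : coeffDerivation δ (curvePoly μ) = -g)
    (hH : (mulMat he hq μ (hess (curvePoly μ))).det ≠ 0) :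
    δ (mulMat he hq μ (curvePoly μ)).det =
      -((mulMat he hq μ (curvePoly μ)).adjugate * mulMat he hq μ g).trace := by
  obtain ⟨t, ht⟩ := mulMat_hess_mul δ he hq μ g hg
  set a := mulMat he hq μ (curvePoly μ)
  set h := mulMat he hq μ (hess (curvePoly μ))
  have hcomm : a * h = h * a := by rw [← map_mul, mul_comm, map_mul]
  -- The adjugate inherits commutation with `a` from `h`, after cancelling `det h` in the domain.
  have hadj : a * h.adjugate = h.adjugate * a := by
    have h1 : h.det • (a * h.adjugate) = h.det • (h.adjugate * a) := by
      calc h.det • (a * h.adjugate) = h.adjugate * h * (a * h.adjugate) := by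
            rw [Matrix.adjugate_mul, Matrix.smul_mul, one_mul]
        _ = h.adjugate * (h * a) * h.adjugate := by simp only [mul_assoc]
        _ = h.adjugate * a * (h * h.adjugate) := by rw [← hcomm]; simp only [mul_assoc]
        _ = h.det • (h.adjugate * a) := by rw [Matrix.mul_adjugate, Matrix.mul_smul, mul_one]
    exact smul_right_injective _ hH h1
  rw [derivation_det, ← add_eq_zero_iff_eq_neg, ← Matrix.trace_add, ← mul_add]
  refine (mul_eq_zero.mp ?_).resolve_left hH
  -- Multiplying by `adj h` removes `h`; the two halves of the commutator then have the same trace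
  -- `det a · tr(adj(h) t)`.
  calc h.det * (a.adjugate * (a.map δ + mulMat he hq μ g)).trace
      = (a.adjugate * (h.det • (a.map δ + mulMat he hq μ g))).trace := by
        rw [Matrix.mul_smul, Matrix.trace_smul, smul_eq_mul]
    _ = (a.adjugate * (h.adjugate * (h * (a.map δ + mulMat he hq μ g)))).trace := by
        rw [← mul_assoc h.adjugate, Matrix.adjugate_mul, Matrix.smul_mul, one_mul]
    _ = (a.adjugate * (h.adjugate * a) * t).trace - (a.adjugate * h.adjugate * t * a).trace := by
        rw [ht, mul_sub, mul_sub, Matrix.trace_sub]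
        simp only [mul_assoc]
    _ = 0 := by
        rw [Matrix.trace_mul_comm (a.adjugate * h.adjugate * t) a, ← hadj, ← mul_assoc,
          Matrix.adjugate_mul, ← mul_assoc, ← mul_assoc, Matrix.mul_adjugate]
        simp

end DetDerivative

/-! ### Partial traces of tensors supported on the diagonal. -/

section DiagonalTensor

open TensorProduct

variable {A J ι : Type*} [CommRing A] [CommRing J] [Algebra A J]

/-- The map `a ⊗ b ↦ τ(b) a`. -/
noncomputable def partialFunctional (τ : J →ₗ[A] A) : J ⊗[A] J →ₗ[A] J :=
  (TensorProduct.rid A J).toLinearMap ∘ₗ LinearMap.lTensor J τ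

@[simp] lemma partialFunctional_tmul (τ : J →ₗ[A] A) (a b : J) :
    partialFunctional τ (a ⊗ₜ[A] b) = τ b • a := by
  simp [partialFunctional]

lemma partialFunctional_left_mul (τ : J →ₗ[A] A) (a : J) (x : J ⊗[A] J) :
    partialFunctional τ ((a ⊗ₜ[A] 1) * x) = a * partialFunctional τ x := by
  induction x with
  | zero => simp
  | tmul c d => simp
  | add x y hx hy => rw [mul_add, map_add, hx, hy, map_add, mul_add]

lemma partialFunctional_right_mul (τ : J →ₗ[A] A) (a : J) (x : J ⊗[A] J) :
    partialFunctional τ ((1 ⊗ₜ[A] a) * x) =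
      partialFunctional (τ ∘ₗ LinearMap.mulLeft A a) x := by
  induction x with
  | zero => simp
  | tmul c d => simp
  | add x y hx hy => rw [mul_add, map_add, hx, hy, map_add]

lemma partialFunctional_mul_algebraMap_mul (τ : J →ₗ[A] A) (a b : J) (c : A) :
    partialFunctional τ ((a ⊗ₜ[A] 1) * algebraMap A (J ⊗[A] J) c * (1 ⊗ₜ[A] b)) = (c * τ b) • a := by
  rw [mul_comm (a ⊗ₜ[A] 1), mul_assoc, ← Algebra.smul_def, map_smul,
    Algebra.TensorProduct.tmul_mul_tmul, one_mul, mul_one, partialFunctional_tmul, mul_smul]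

lemma partialFunctional_smul (c : A) (τ : J →ₗ[A] A) (x : J ⊗[A] J) :
    partialFunctional (c • τ) x = c • partialFunctional τ x := by
  induction x with
  | zero => simp
  | tmul a b => simp [mul_smul]
  | add x y hx hy => rw [map_add, hx, hy, map_add, smul_add]

/-- The partial trace of a tensor supported on the diagonal is its restriction to the diagonal. -/
lemma partialFunctional_trace [Fintype ι] [DecidableEq ι] (b : Module.Basis ι A J) {h : J ⊗[A] J}
    (hh : ∀ a : J, (a ⊗ₜ[A] 1) * h = (1 ⊗ₜ[A] a) * h) :
    partialFunctional (Algebra.trace A J) h = Algebra.TensorProduct.lmul' A h := by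
  -- The trace is expanded as `tr(d) = ∑ j, b_j*(b_j d)`. For `h`, the factor `b_j` moves to the
  -- left tensor slot by `hh`, and `∑ j, b_j · b_j*(d) = d` leaves the multiplication map.
  have h1 : ∀ x : J ⊗[A] J, partialFunctional (Algebra.trace A J) x =
      ∑ j, partialFunctional (b.coord j) ((1 ⊗ₜ[A] b j) * x) := by
    intro x
    induction x with
    | zero => simp
    | tmul c d =>
      simp only [partialFunctional_tmul, Algebra.TensorProduct.tmul_mul_tmul, one_mul,
        ← Finset.sum_smul]
      rw [Algebra.trace_eq_matrix_trace b, Matrix.trace]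
      congr 1
      refine Finset.sum_congr rfl fun j _ => ?_
      rw [Matrix.diag_apply, Algebra.leftMulMatrix_eq_repr_mul, mul_comm, Module.Basis.coord_apply]
    | add x y hx hy => simp only [mul_add, map_add, hx, hy, Finset.sum_add_distrib]
  have h2 : ∀ x : J ⊗[A] J, ∑ j, b j * partialFunctional (b.coord j) x =
      Algebra.TensorProduct.lmul' A x := by
    intro x
    induction x with
    | zero => simp
    | tmul c d =>
      rw [Algebra.TensorProduct.lmul'_apply_tmul]
      conv_rhs => rw [← b.sum_repr d, Finset.mul_sum]
      refine Finset.sum_congr rfl fun j _ => ?_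
      rw [partialFunctional_tmul, Module.Basis.coord_apply, mul_smul_comm, mul_smul_comm, mul_comm]
    | add x y hx hy => simp only [mul_add, map_add, hx, hy, Finset.sum_add_distrib]
  rw [h1, ← h2]
  exact Finset.sum_congr rfl fun j _ => by rw [← hh, partialFunctional_left_mul]

end DiagonalTensor

/-! ### Bezoutians and the Jacobian determinant. -/

section Bezoutian

variable {A : Type*} [CommRing A]

lemma pderiv_sub (p : MvPolynomial (Fin 2) A) (u v : MvPolynomial (Fin 4) A) (i : Fin 4) :
    pderiv i (sub p u v) =
      sub (pderiv 0 p) u v * pderiv i u + sub (pderiv 1 p) u v * pderiv i v := by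
  induction p using MvPolynomial.induction_on with
  | C a => simp [sub]
  | add p r hp hr =>
    simp only [sub, map_add] at hp hr ⊢
    rw [hp, hr]
    ring
  | mul_X p j hp =>
    simp only [sub] at hp
    fin_cases j
    · simp [sub, hp, Derivation.leibniz, -aeval_eq_bind₁]
      ring
    · simp [sub, hp, Derivation.leibniz, -aeval_eq_bind₁]
      ring

/-- The restriction to the diagonal `(z, w) = (x, y)`. -/
noncomputable def diagonal : MvPolynomial (Fin 4) A →ₐ[A] MvPolynomial (Fin 2) A :=
  aeval ![X 0, X 1, X 0, X 1]

lemma diagonal_sub (p : MvPolynomial (Fin 2) A) (u v : MvPolynomial (Fin 4) A) :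
    diagonal (sub p u v) = aeval ![diagonal u, diagonal v] p := by
  unfold sub
  rw [← AlgHom.comp_apply, comp_aeval]
  congr 2
  funext i
  fin_cases i <;> rfl

lemma aeval_X_zero_X_one (p : MvPolynomial (Fin 2) A) :
    aeval (![X 0, X 1] : Fin 2 → MvPolynomial (Fin 2) A) p = p := by
  have h : (![X 0, X 1] : Fin 2 → MvPolynomial (Fin 2) A) = X := by
    funext i
    fin_cases i <;> rfl
  rw [h, aeval_X_left_apply]

@[simp] lemma diagonal_X_zero : diagonal (X 0 : MvPolynomial (Fin 4) A) = X 0 := by simp [diagonal]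
@[simp] lemma diagonal_X_one : diagonal (X 1 : MvPolynomial (Fin 4) A) = X 1 := by simp [diagonal]
@[simp] lemma diagonal_X_two : diagonal (X 2 : MvPolynomial (Fin 4) A) = X 0 := by simp [diagonal]
@[simp] lemma diagonal_X_three : diagonal (X 3 : MvPolynomial (Fin 4) A) = X 1 := by
  simp [diagonal]

/-- On the diagonal the factor `x - z` vanishes, so differentiating the defining equation in `x`
isolates the value of `u` there. The index `j` leaves the second coordinate free to be `y` or `w`.
-/
lemma exists_divided_zero (p : MvPolynomial (Fin 2) A) (j : Fin 4) (hj : j = 1 ∨ j = 3) :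
    ∃ u, (X 0 - X 2) * u = sub p (X 0) (X j) - sub p (X 2) (X j) ∧ diagonal u = pderiv 0 p := by
  have h := dvd_sub_aeval (X 0 - X 2) (![X 2, X 1, X 2, X 3] : Fin 4 → MvPolynomial (Fin 4) A)
    (by intro i; fin_cases i <;> simp) (sub p (X 0) (X j))
  obtain ⟨u, hu⟩ := h
  have hu' : (X 0 - X 2) * u = sub p (X 0) (X j) - sub p (X 2) (X j) := by
    rw [← hu, aeval_sub]
    rcases hj with rfl | rfl <;> simp
  refine ⟨u, hu', ?_⟩
  have hd := congrArg (fun r => diagonal (pderiv 0 r)) hu'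
  rcases hj with rfl | rfl <;>
  simpa [Derivation.leibniz, pderiv_sub, pderiv_X_self, pderiv_X_of_ne, diagonal_sub,
    aeval_X_zero_X_one, -aeval_eq_bind₁] using hd

lemma exists_divided_one (p : MvPolynomial (Fin 2) A) (j : Fin 4) (hj : j = 0 ∨ j = 2) :
    ∃ u, (X 1 - X 3) * u = sub p (X j) (X 1) - sub p (X j) (X 3) ∧ diagonal u = pderiv 1 p := by
  have h := dvd_sub_aeval (X 1 - X 3) (![X 0, X 3, X 2, X 3] : Fin 4 → MvPolynomial (Fin 4) A)
    (by intro i; fin_cases i <;> simp) (sub p (X j) (X 1))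
  obtain ⟨u, hu⟩ := h
  have hu' : (X 1 - X 3) * u = sub p (X j) (X 1) - sub p (X j) (X 3) := by
    rw [← hu, aeval_sub]
    rcases hj with rfl | rfl <;> simp
  refine ⟨u, hu', ?_⟩
  have hd := congrArg (fun r => diagonal (pderiv 1 r)) hu'
  rcases hj with rfl | rfl <;>
  simpa [Derivation.leibniz, pderiv_sub, pderiv_X_self, pderiv_X_of_ne, diagonal_sub,
    aeval_X_zero_X_one, -aeval_eq_bind₁] using hd

lemma X_sub_X_ne_zero [IsDomain A] {i j : Fin 4} (h : i ≠ j) :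
    (X i - X j : MvPolynomial (Fin 4) A) ≠ 0 :=
  sub_ne_zero.mpr fun h' => h (X_injective h')

/-- The Bezoutian of two polynomials is supported on the diagonal modulo the polynomials, and
restricts to twice the Jacobian determinant there. -/
lemma bezoutian_properties [IsDomain A] {p₁ p₂ : MvPolynomial (Fin 2) A}
    {B : MvPolynomial (Fin 4) A} (hB : (X 0 - X 2) * (X 1 - X 3) * B = bezoutNumerator p₁ p₂)
    {S : Type*} [CommRing S] (ψ : MvPolynomial (Fin 4) A →+* S)
    (h₁ : ψ (sub p₁ (X 0) (X 1)) = ψ (sub p₁ (X 2) (X 3)))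
    (h₂ : ψ (sub p₂ (X 0) (X 1)) = ψ (sub p₂ (X 2) (X 3))) :
    ψ (X 0) * ψ B = ψ (X 2) * ψ B ∧ ψ (X 1) * ψ B = ψ (X 3) * ψ B ∧
      diagonal B = 2 * (pderiv 0 p₁ * pderiv 1 p₂ - pderiv 0 p₂ * pderiv 1 p₁) := by
  obtain ⟨u₁, hu₁, du₁⟩ := exists_divided_zero p₁ 1 (Or.inl rfl)
  obtain ⟨u₂, hu₂, du₂⟩ := exists_divided_zero p₂ 1 (Or.inl rfl)
  obtain ⟨s₁, hs₁, ds₁⟩ := exists_divided_zero p₁ 3 (Or.inr rfl)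
  obtain ⟨s₂, hs₂, ds₂⟩ := exists_divided_zero p₂ 3 (Or.inr rfl)
  obtain ⟨v₁, hv₁, dv₁⟩ := exists_divided_one p₁ 2 (Or.inr rfl)
  obtain ⟨v₂, hv₂, dv₂⟩ := exists_divided_one p₂ 2 (Or.inr rfl)
  obtain ⟨t₁, ht₁, dt₁⟩ := exists_divided_one p₁ 0 (Or.inl rfl)
  obtain ⟨t₂, ht₂, dt₂⟩ := exists_divided_one p₂ 0 (Or.inl rfl)
  -- Two paths lead from `(x,y)` to `(z,w)`, through `(z,y)` and through `(x,w)`. Each gives a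
  -- determinant of divided differences, killed by `x - z` and `y - w` by Cramer's rule and equal to
  -- the Jacobian on the diagonal. `B` is their sum, which explains the factor `1/2` in `H`.
  have hB' : B = u₁ * v₂ - u₂ * v₁ + (s₁ * t₂ - s₂ * t₁) := by
    refine mul_left_cancel₀ (mul_ne_zero (X_sub_X_ne_zero (i := 0) (j := 2) (by decide))
      (X_sub_X_ne_zero (i := 1) (j := 3) (by decide))) ?_
    rw [hB, bezoutNumerator, Matrix.det_fin_two_of]
    linear_combination -((X 1 - X 3) * v₂) * hu₁ + ((X 1 - X 3) * v₁) * hu₂ -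
      (sub p₁ (X 0) (X 1) - sub p₁ (X 2) (X 1)) * hv₂ +
      (sub p₂ (X 0) (X 1) - sub p₂ (X 2) (X 1)) * hv₁ -
      ((X 1 - X 3) * t₂) * hs₁ + ((X 1 - X 3) * t₁) * hs₂ -
      (sub p₁ (X 0) (X 3) - sub p₁ (X 2) (X 3)) * ht₂ +
      (sub p₂ (X 0) (X 3) - sub p₂ (X 2) (X 3)) * ht₁
  have e₁ := congrArg ψ (congrArg₂ (· + ·) hu₁ hv₁)
  have e₂ := congrArg ψ (congrArg₂ (· + ·) hu₂ hv₂)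
  have e₃ := congrArg ψ (congrArg₂ (· + ·) hs₁ ht₁)
  have e₄ := congrArg ψ (congrArg₂ (· + ·) hs₂ ht₂)
  simp only [map_add, map_mul, map_sub] at e₁ e₂ e₃ e₄
  rw [hB']
  simp only [map_add, map_mul, map_sub]
  refine ⟨?_, ?_, ?_⟩
  · linear_combination ψ v₂ * (e₁ + h₁) - ψ v₁ * (e₂ + h₂) + ψ t₂ * (e₃ + h₁) - ψ t₁ * (e₄ + h₂)
  · linear_combination ψ u₁ * (e₂ + h₂) - ψ u₂ * (e₁ + h₁) + ψ s₁ * (e₄ + h₂) - ψ s₂ * (e₃ + h₁)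
  · rw [du₁, du₂, ds₁, ds₂, dv₁, dv₂, dt₁, dt₂]
    ring

end Bezoutian

/-! ### Existence of the matrix `V`. -/

section MatrixV

variable {e q : ℕ}

/-- The element `ᵗM(x,y) V M(z,w)`. -/
noncomputable def bilinearForm (V : Matrix (Idx e q) (Idx e q) (ParamRing e q)) :
    MvPolynomial (Fin 4) (ParamRing e q) :=
  ∑ k, ∑ l, sub (mono _ k) (X 0) (X 1) * C (V k l) * sub (mono _ l) (X 2) (X 3)

lemma sub_mem_jacobianIdeal₂_left {p : MvPolynomial (Fin 2) (ParamRing e q)}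
    (hp : p ∈ jacIdeal (fun k : Idx e q => (X k : ParamRing e q))) :
    sub p (X 0) (X 1) ∈ jacobianIdeal₂ e q := by
  obtain ⟨α, β, rfl⟩ := Ideal.mem_span_pair.mp hp
  simp only [sub, map_add, map_mul]
  exact Ideal.add_mem _ (Ideal.mul_mem_left _ _ (Ideal.subset_span (Or.inl rfl)))
    (Ideal.mul_mem_left _ _ (Ideal.subset_span (Or.inr (Or.inl rfl))))

lemma sub_mem_jacobianIdeal₂_right {p : MvPolynomial (Fin 2) (ParamRing e q)}
    (hp : p ∈ jacIdeal (fun k : Idx e q => (X k : ParamRing e q))) :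
    sub p (X 2) (X 3) ∈ jacobianIdeal₂ e q := by
  obtain ⟨α, β, rfl⟩ := Ideal.mem_span_pair.mp hp
  simp only [sub, map_add, map_mul]
  exact Ideal.add_mem _ (Ideal.mul_mem_left _ _ (Ideal.subset_span (Or.inr (Or.inr (Or.inl rfl)))))
    (Ideal.mul_mem_left _ _ (Ideal.subset_span (Or.inr (Or.inr (Or.inr rfl)))))

variable (he : 2 ≤ e) (hq : 2 ≤ q)

lemma sub_sum_C_mul_mono {A : Type*} [CommRing A] (c : Idx e q → A)
    (u v : MvPolynomial (Fin 4) A) :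
    sub (∑ j, C (c j) * mono A j) u v = ∑ j, C (c j) * sub (mono A j) u v := by
  simp [sub, algebraMap_eq]

lemma mk_sub_mul_bilinearForm_left (p : MvPolynomial (Fin 2) (ParamRing e q))
    (V : Matrix (Idx e q) (Idx e q) (ParamRing e q)) :
    Ideal.Quotient.mk (jacobianIdeal₂ e q) (sub p (X 0) (X 1) * bilinearForm V) =
      Ideal.Quotient.mk (jacobianIdeal₂ e q)
        (bilinearForm (mulMat he hq (fun k => X k) p * V)) := by
  set a := mulMat he hq (fun k => (X k : ParamRing e q)) p with ha
  have h1 : ∀ k, Ideal.Quotient.mk (jacobianIdeal₂ e q)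
      (sub p (X 0) (X 1) * sub (mono _ k) (X 0) (X 1)) = Ideal.Quotient.mk (jacobianIdeal₂ e q)
        (∑ j, C (a j k) * sub (mono _ j) (X 0) (X 1)) := by
    intro k
    have h := sub_mem_jacobianIdeal₂_left
      (mulMat_spec he hq (fun k => (X k : ParamRing e q)) p k)
    rw [← sub_sum_C_mul_mono, Ideal.Quotient.eq]
    simpa only [sub, map_sub, map_mul] using h
  have h2 : bilinearForm (a * V) = ∑ k, ∑ l,
      (∑ j, C (a j k) * sub (mono _ j) (X 0) (X 1)) * C (V k l) * sub (mono _ l) (X 2) (X 3) := by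
    simp only [bilinearForm, Matrix.mul_apply, map_sum, Finset.mul_sum, Finset.sum_mul]
    rw [Finset.sum_comm]
    conv_rhs => rw [Finset.sum_comm]
    refine Finset.sum_congr rfl fun l _ => ?_
    rw [Finset.sum_comm]
    refine Finset.sum_congr rfl fun k _ => Finset.sum_congr rfl fun j _ => ?_
    rw [C_mul]
    ring
  rw [h2, bilinearForm, Finset.mul_sum, map_sum, map_sum]
  refine Finset.sum_congr rfl fun k _ => ?_
  rw [Finset.mul_sum, map_sum, map_sum]
  refine Finset.sum_congr rfl fun l _ => ?_
  rw [← mul_assoc, ← mul_assoc, map_mul, map_mul, h1, ← map_mul, ← map_mul]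

lemma mk_sub_mul_bilinearForm_right (p : MvPolynomial (Fin 2) (ParamRing e q))
    (V : Matrix (Idx e q) (Idx e q) (ParamRing e q)) :
    Ideal.Quotient.mk (jacobianIdeal₂ e q) (sub p (X 2) (X 3) * bilinearForm V) =
      Ideal.Quotient.mk (jacobianIdeal₂ e q)
        (bilinearForm (V * (mulMat he hq (fun k => X k) p).transpose)) := by
  set a := mulMat he hq (fun k => (X k : ParamRing e q)) p with ha
  have h1 : ∀ k, Ideal.Quotient.mk (jacobianIdeal₂ e q)
      (sub p (X 2) (X 3) * sub (mono _ k) (X 2) (X 3)) = Ideal.Quotient.mk (jacobianIdeal₂ e q)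
        (∑ j, C (a j k) * sub (mono _ j) (X 2) (X 3)) := by
    intro k
    have h := sub_mem_jacobianIdeal₂_right
      (mulMat_spec he hq (fun k => (X k : ParamRing e q)) p k)
    rw [← sub_sum_C_mul_mono, Ideal.Quotient.eq]
    simpa only [sub, map_sub, map_mul] using h
  have h2 : bilinearForm (V * a.transpose) = ∑ k, ∑ l,
      sub (mono _ k) (X 0) (X 1) * C (V k l) *
        (∑ j, C (a j l) * sub (mono _ j) (X 2) (X 3)) := by
    simp only [bilinearForm, Matrix.mul_apply, Matrix.transpose_apply, map_sum, Finset.mul_sum,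
      Finset.sum_mul]
    refine Finset.sum_congr rfl fun k _ => ?_
    rw [Finset.sum_comm]
    refine Finset.sum_congr rfl fun l _ => Finset.sum_congr rfl fun j _ => ?_
    rw [C_mul]
    ring
  rw [h2, bilinearForm, Finset.mul_sum, map_sum, map_sum]
  refine Finset.sum_congr rfl fun k _ => ?_
  rw [Finset.mul_sum, map_sum, map_sum]
  refine Finset.sum_congr rfl fun l _ => ?_
  rw [mul_left_comm, map_mul, h1, ← map_mul]

/-- The classes of the forms `ᵗM V M` contain the constants and are stable under sums and under
multiplication by each variable, which acts on `V` through a multiplication matrix on the left or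
the right. -/
lemma exists_mk_bilinearForm_eq (he : 2 ≤ e) (hq : 2 ≤ q)
    (p : MvPolynomial (Fin 4) (ParamRing e q)) :
    ∃ V, Ideal.Quotient.mk (jacobianIdeal₂ e q) (bilinearForm V) =
      Ideal.Quotient.mk (jacobianIdeal₂ e q) p := by
  induction p using MvPolynomial.induction_on with
  | C c =>
    refine ⟨Matrix.single (zeroIdx he hq) (zeroIdx he hq) c, ?_⟩
    congr 1
    rw [bilinearForm, Finset.sum_eq_single (zeroIdx he hq), Finset.sum_eq_single (zeroIdx he hq)]
    · simp [mono_zeroIdx, sub]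
    · intro l _ hl
      rw [Matrix.single_apply_of_col_ne _ _ hl.symm]
      simp
    · simp
    · intro k _ hk
      refine Finset.sum_eq_zero fun l _ => ?_
      rw [Matrix.single_apply_of_row_ne hk.symm]
      simp
    · simp
  | add p r hp hr =>
    obtain ⟨V, hV⟩ := hp
    obtain ⟨W, hW⟩ := hr
    refine ⟨V + W, ?_⟩
    rw [map_add, ← hV, ← hW, ← map_add]
    congr 1
    simp [bilinearForm, mul_add, add_mul, Finset.sum_add_distrib]
  | mul_X p i hp =>
    obtain ⟨V, hV⟩ := hp
    rw [map_mul, ← hV, ← map_mul, mul_comm]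
    have h : ∀ u v : MvPolynomial (Fin 4) (ParamRing e q), sub (X 0) u v = u ∧ sub (X 1) u v = v :=
      fun u v => ⟨by simp [sub], by simp [sub]⟩
    obtain rfl | rfl | rfl | rfl : i = 0 ∨ i = 1 ∨ i = 2 ∨ i = 3 := by omega
    · exact ⟨_, by simpa only [(h _ _).1] using (mk_sub_mul_bilinearForm_left he hq (X 0) V).symm⟩
    · exact ⟨_, by simpa only [(h _ _).2] using (mk_sub_mul_bilinearForm_left he hq (X 1) V).symm⟩
    · exact ⟨_, by simpa only [(h _ _).1] using (mk_sub_mul_bilinearForm_right he hq (X 0) V).symm⟩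
    · exact ⟨_, by simpa only [(h _ _).2] using (mk_sub_mul_bilinearForm_right he hq (X 1) V).symm⟩

lemma exists_isV (he : 2 ≤ e) (hq : 2 ≤ q) : ∃ V, IsV e q V :=
  exists_mk_bilinearForm_eq he hq _

end MatrixV

/-! ### The action of `L` on the norm of `f`. -/

section NormDerivative

open TensorProduct

variable {e q : ℕ}

/-- The ring `ℚ[μ][x,y] / (f_x, f_y)`. -/
abbrev JacRing (e q : ℕ) : Type :=
  MvPolynomial (Fin 2) (ParamRing e q) ⧸ jacIdeal (fun k : Idx e q => (X k : ParamRing e q))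

/-- The class of a polynomial in `ℚ[μ][x,y] / (f_x, f_y)`. -/
noncomputable def jacMk (e q : ℕ) : MvPolynomial (Fin 2) (ParamRing e q) →ₐ[ParamRing e q]
    JacRing e q :=
  Ideal.Quotient.mkₐ _ _

lemma jacMk_surjective : Function.Surjective (jacMk e q) := Ideal.Quotient.mk_surjective

/-- The map from `ℚ[μ][x,y,z,w]` to the tensor square of `ℚ[μ][x,y] / (f_x, f_y)`. -/
noncomputable def tensorEval (e q : ℕ) : MvPolynomial (Fin 4) (ParamRing e q) →ₐ[ParamRing e q]
    JacRing e q ⊗[ParamRing e q] JacRing e q :=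
  aeval (![jacMk e q (X 0) ⊗ₜ 1, jacMk e q (X 1) ⊗ₜ 1, 1 ⊗ₜ jacMk e q (X 0),
    1 ⊗ₜ jacMk e q (X 1)] : Fin 4 → JacRing e q ⊗[ParamRing e q] JacRing e q)

lemma tensorEval_sub_left (p : MvPolynomial (Fin 2) (ParamRing e q)) :
    tensorEval e q (sub p (X 0) (X 1)) = jacMk e q p ⊗ₜ 1 := by
  have h : (tensorEval e q).comp (aeval ![X 0, X 1]) =
      (Algebra.TensorProduct.includeLeft).comp (jacMk e q) := by
    ext i
    fin_cases i <;> simp [tensorEval]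
  exact DFunLike.congr_fun h p

lemma tensorEval_sub_right (p : MvPolynomial (Fin 2) (ParamRing e q)) :
    tensorEval e q (sub p (X 2) (X 3)) = 1 ⊗ₜ jacMk e q p := by
  have h : (tensorEval e q).comp (aeval ![X 2, X 3]) =
      (Algebra.TensorProduct.includeRight).comp (jacMk e q) := by
    ext i
    fin_cases i <;> simp [tensorEval]
  exact DFunLike.congr_fun h p

lemma jacMk_fx : jacMk e q (fx e q) = 0 :=
  Ideal.Quotient.eq_zero_iff_mem.mpr (pderiv_zero_mem_jacIdeal _)

lemma jacMk_fy : jacMk e q (fy e q) = 0 :=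
  Ideal.Quotient.eq_zero_iff_mem.mpr (pderiv_one_mem_jacIdeal _)

lemma tensorEval_eq_zero {p : MvPolynomial (Fin 4) (ParamRing e q)}
    (hp : p ∈ jacobianIdeal₂ e q) : tensorEval e q p = 0 := by
  have h : jacobianIdeal₂ e q ≤ RingHom.ker (tensorEval e q) := by
    rw [jacobianIdeal₂, Ideal.span_le]
    rintro x (rfl | rfl | rfl | rfl)
    · simp [RingHom.mem_ker, tensorEval_sub_left, jacMk_fx]
    · simp [RingHom.mem_ker, tensorEval_sub_left, jacMk_fy]
    · simp [RingHom.mem_ker, tensorEval_sub_right, jacMk_fx]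
    · simp [RingHom.mem_ker, tensorEval_sub_right, jacMk_fy]
  exact h hp

lemma lmul'_tensorEval (p : MvPolynomial (Fin 4) (ParamRing e q)) :
    Algebra.TensorProduct.lmul' (ParamRing e q) (tensorEval e q p) = jacMk e q (diagonal p) := by
  have h : (Algebra.TensorProduct.lmul' (ParamRing e q)).comp (tensorEval e q) =
      (jacMk e q).comp diagonal := by
    ext i
    fin_cases i <;> simp [tensorEval]
  exact DFunLike.congr_fun h p

lemma two_mul_C_C_half :
    (2 : MvPolynomial (Fin 2) (ParamRing e q)) * C (C (1 / 2)) = 1 := by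
  have h2 : (2 : MvPolynomial (Fin 2) (ParamRing e q)) = C (C 2) := by
    rw [map_ofNat (C : ℚ →+* ParamRing e q) 2, map_ofNat]
  rw [h2, ← C_mul, ← C_mul]
  norm_num

lemma mul_mul_eq_of_mul_eq {S : Type*} [CommRing S] {a b y : S} (h : a * y = b * y) (c : S) :
    a * (c * y) = b * (c * y) := by
  rw [mul_left_comm, h, mul_left_comm]

lemma mul_mul_eq_of_mul_eq_of_mul_eq {S : Type*} [CommRing S] {a b c d y : S}
    (h : a * y = b * y) (h' : c * y = d * y) : a * c * y = b * d * y := by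
  linear_combination d * h + a * h'

lemma tensorEval_H_properties :
    (∀ a : JacRing e q, (a ⊗ₜ[ParamRing e q] 1) * tensorEval e q (H e q) =
      (1 ⊗ₜ[ParamRing e q] a) * tensorEval e q (H e q)) ∧
    Algebra.TensorProduct.lmul' (ParamRing e q) (tensorEval e q (H e q)) =
      jacMk e q (hess (genericPoly e q)) := by
  set B := Classical.choose (exists_bezout (fx e q) (fy e q)) with hBdef
  have hB := Classical.choose_spec (exists_bezout (fx e q) (fy e q))
  rw [← hBdef] at hB
  have hH : H e q = C (C (1 / 2)) * B := rfl
  obtain ⟨h0, h1, hd⟩ := bezoutian_properties hB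
    (S := JacRing e q ⊗[ParamRing e q] JacRing e q) (tensorEval e q : _ →+* _)
    (by simp [tensorEval_sub_left, tensorEval_sub_right, jacMk_fx])
    (by simp [tensorEval_sub_left, tensorEval_sub_right, jacMk_fy])
  have e0 : tensorEval e q (X 0) = jacMk e q (X 0) ⊗ₜ 1 := by simp [tensorEval]
  have e1 : tensorEval e q (X 1) = jacMk e q (X 1) ⊗ₜ 1 := by simp [tensorEval]
  have e2 : tensorEval e q (X 2) = 1 ⊗ₜ jacMk e q (X 0) := by simp [tensorEval]
  have e3 : tensorEval e q (X 3) = 1 ⊗ₜ jacMk e q (X 1) := by simp [tensorEval]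
  replace h0 : tensorEval e q (X 0) * tensorEval e q B = tensorEval e q (X 2) * tensorEval e q B :=
    h0
  replace h1 : tensorEval e q (X 1) * tensorEval e q B = tensorEval e q (X 3) * tensorEval e q B :=
    h1
  rw [e0, e2] at h0
  rw [e1, e3] at h1
  have hX : ∀ i : Fin 2, (jacMk e q (X i) ⊗ₜ[ParamRing e q] 1) * tensorEval e q B =
      (1 ⊗ₜ[ParamRing e q] jacMk e q (X i)) * tensorEval e q B := by
    intro i
    fin_cases i
    · exact h0
    · exact h1
  constructor
  · intro a
    obtain ⟨p, rfl⟩ := jacMk_surjective a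
    rw [hH, map_mul]
    refine mul_mul_eq_of_mul_eq (S := JacRing e q ⊗[ParamRing e q] JacRing e q) ?_ _
    rw [← tensorEval_sub_left, ← tensorEval_sub_right]
    induction p using MvPolynomial.induction_on with
    | C c => simp [sub]
    | add p r hp hr =>
      simp only [sub, map_add, add_mul] at hp hr ⊢
      rw [hp, hr]
    | mul_X p i hp =>
      have hl : ∀ u v : MvPolynomial (Fin 4) (ParamRing e q),
          sub (p * X i) u v = sub p u v * sub (X i) u v := fun u v => by simp only [sub, map_mul]
      rw [hl, hl, map_mul, map_mul]
      refine mul_mul_eq_of_mul_eq_of_mul_eq (S := JacRing e q ⊗[ParamRing e q] JacRing e q) hp ?_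
      rw [tensorEval_sub_left, tensorEval_sub_right]
      exact hX i
  · rw [lmul'_tensorEval, hH, map_mul, hd]
    congr 1
    have hC : diagonal (C (C (1 / 2)) : MvPolynomial (Fin 4) (ParamRing e q)) = C (C (1 / 2)) := by
      simp [diagonal, algebraMap_eq]
    rw [hC, hess, Matrix.det_fin_two_of]
    simp only [fx, fy]
    linear_combination (pderiv 0 (pderiv 0 (genericPoly e q)) * pderiv 1 (pderiv 1 (genericPoly e q))
      - pderiv 0 (pderiv 1 (genericPoly e q)) * pderiv 1 (pderiv 0 (genericPoly e q))) *
      two_mul_C_C_half (e := e) (q := q)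

lemma weierstrassSupport_eq_univ (he : 2 ≤ e) (hq : 2 ≤ q) (hmod : modality e q = 0) :
    weierstrassSupport e q = Finset.univ := by
  rw [← Finset.card_eq_iff_eq_univ]
  rw [modality] at hmod
  have h : (((e - 1 : ℕ) : ℤ)) * ((q - 1 : ℕ) : ℤ) = (weierstrassSupport e q).card := by
    rw [Nat.cast_sub (by omega), Nat.cast_sub (by omega)]
    push_cast
    linarith
  rw [Fintype.card_prod, Fintype.card_fin, Fintype.card_fin, mul_comm]
  exact_mod_cast h.symm

/-- The norm of `f` over `ℚ[μ]`. -/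
noncomputable def normPoly (he : 2 ≤ e) (hq : 2 ≤ q) : ParamRing e q :=
  (mulMat he hq (fun k => (X k : ParamRing e q)) (genericPoly e q)).det

variable (he : 2 ≤ e) (hq : 2 ≤ q)

/-- Modality `0` enters here: every `μ_l` occurs in `f`, so `∂f/∂μ_l = -M_l` without exception. -/
lemma pderiv_normPoly (hmod : modality e q = 0)
    (hH : (mulMat he hq (fun k => (X k : ParamRing e q)) (hess (genericPoly e q))).det ≠ 0)
    (l : Idx e q) :
    pderiv l (normPoly he hq) =
      -((mulMat he hq (fun k => X k) (genericPoly e q)).adjugate *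
        mulMat he hq (fun k => X k) (mono _ l)).trace := by
  refine derivation_det_mulMat (pderiv l) he hq (fun k => X k) (mono _ l) ?_ hH
  rw [coeffDerivation_curvePoly, weierstrassSupport_eq_univ he hq hmod,
    Finset.sum_eq_single l]
  · simp
  · intro k _ hk
    rw [pderiv_X_of_ne hk]
    simp
  · simp

lemma rowField_apply (V : Matrix (Idx e q) (Idx e q) (ParamRing e q)) (k : Idx e q)
    (D : ParamRing e q) : rowField V k D = ∑ l, V k l * pderiv l D := by
  have h : ∀ s : Finset (Idx e q), (∑ l ∈ s, V k l • (pderiv l : Derivation ℚ (ParamRing e q) _)) D =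
      ∑ l ∈ s, V k l * pderiv l D := by
    classical
    intro s
    induction s using Finset.induction_on with
    | empty => simp
    | insert a s ha ih => simp [Finset.sum_insert ha, ih]
  exact h Finset.univ

/-- The operator `L` multiplies the norm of `f` by minus the Hessian determinant. -/
theorem mk_opL_normPoly (hmod : modality e q = 0)
    (hH : (mulMat he hq (fun k => (X k : ParamRing e q)) (hess (genericPoly e q))).det ≠ 0)
    {V : Matrix (Idx e q) (Idx e q) (ParamRing e q)} (hV : IsV e q V) :
    jacMk e q (opL V (normPoly he hq)) =
      -(normPoly he hq • jacMk e q (hess (genericPoly e q))) := by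
  set b := jacBasis he hq (fun k => (X k : ParamRing e q))
  set a := mulMat he hq (fun k => (X k : ParamRing e q)) (genericPoly e q) with ha
  obtain ⟨hdiag, hlmul⟩ := tensorEval_H_properties (e := e) (q := q)
  let τ : JacRing e q →ₗ[ParamRing e q] ParamRing e q :=
    Matrix.traceLinearMap _ _ _ ∘ₗ LinearMap.mulLeft _ a.adjugate ∘ₗ
      (Algebra.leftMulMatrix b).toLinearMap
  have hτ : ∀ p, τ (jacMk e q p) = (a.adjugate * mulMat he hq (fun k => X k) p).trace :=
    fun p => rfl
  -- This is `adj(a) a = N · 1` read through the trace.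
  have hτf : τ ∘ₗ LinearMap.mulLeft _ (jacMk e q (genericPoly e q)) =
      normPoly he hq • Algebra.trace (ParamRing e q) (JacRing e q) := by
    refine LinearMap.ext fun x => ?_
    obtain ⟨p, rfl⟩ := jacMk_surjective x
    rw [LinearMap.comp_apply, LinearMap.mulLeft_apply, ← map_mul, hτ, map_mul, ← mul_assoc, ← ha,
      Matrix.adjugate_mul, Matrix.smul_mul, one_mul, Matrix.trace_smul, LinearMap.smul_apply,
      Algebra.trace_eq_matrix_trace b]
    rfl
  have hV' : tensorEval e q (bilinearForm V) =
      tensorEval e q (sub (genericPoly e q) (X 0) (X 1) * H e q) := by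
    rw [← sub_eq_zero, ← map_sub]
    exact tensorEval_eq_zero (Ideal.Quotient.eq.mp hV)
  -- Diagonal support of `H` moves `f` from the variables `x, y` to `z, w`, where `τ` is applied.
  rw [map_mul, tensorEval_sub_left, hdiag] at hV'
  have h := congrArg (partialFunctional τ) hV'
  rw [partialFunctional_right_mul, hτf, partialFunctional_smul,
    partialFunctional_trace b hdiag, hlmul] at h
  rw [← h, bilinearForm, map_sum, map_sum, opL, map_sum, ← Finset.sum_neg_distrib]
  refine Finset.sum_congr rfl fun k _ => ?_
  have hrow : rowField V k (normPoly he hq) = -∑ l, V k l * τ (jacMk e q (mono _ l)) := by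
    simp only [rowField_apply, pderiv_normPoly he hq hmod hH, hτ, mul_neg, Finset.sum_neg_distrib]
    rfl
  rw [hrow, ← smul_eq_C_mul, map_smul, neg_smul, Finset.sum_smul, map_sum, map_sum]
  congr 1
  refine Finset.sum_congr rfl fun l _ => ?_
  have hC : tensorEval e q (C (V k l)) = algebraMap _ _ (V k l) :=
    (tensorEval e q).commutes (V k l)
  rw [map_mul (tensorEval e q), map_mul (tensorEval e q), hC, tensorEval_sub_left, tensorEval_sub_right]
  exact (partialFunctional_mul_algebraMap_mul τ _ _ _).symm

end NormDerivative

/-! ### A Morse curve with distinct critical values. -/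

section SpecialCurve

/-- For `e = 2` no monomial involves `y`, so `c = 0` is forced and the single ordinate is `0`; there
`y ^ (e-2)` is `0 ^ 0 = 1`. For `e ≥ 3` the roots of unity with `c = 1` serve. -/
lemma exists_critical_ordinates {e : ℕ} (he : 2 ≤ e) :
    ∃ (c : ℂ) (Y : Finset ℂ), Y.card = e - 1 ∧ (e = 2 → c = 0) ∧
      (∀ y ∈ Y, y ^ (e - 1) = c) ∧ (∀ y : ℂ, y ^ (e - 1) = c → y ^ (e - 2) ≠ 0) ∧
      ∀ y ∈ Y, ∀ y' ∈ Y, c * y = c * y' → y = y' := by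
  rcases he.eq_or_lt with rfl | h
  · refine ⟨0, {0}, by simp, fun _ => rfl, by simp, by simp, ?_⟩
    intro y hy y' hy' _
    rw [Finset.mem_singleton.mp hy, Finset.mem_singleton.mp hy']
  · refine ⟨1, Polynomial.nthRootsFinset (e - 1) (1 : ℂ),
      (Complex.isPrimitiveRoot_exp (e - 1) (by omega)).card_nthRootsFinset, by omega, ?_, ?_, ?_⟩
    · intro y hy
      exact (Polynomial.mem_nthRootsFinset (by omega) _).mp hy
    · intro y hy hy0
      have : y = 0 := eq_zero_of_pow_eq_zero hy0
      rw [this, zero_pow (by omega)] at hy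
      exact zero_ne_one hy
    · intro y _ y' _ hyy
      simpa using hyy

/-- Each coincidence with `z ≠ z'` excludes a single value of `r`, so finitely many values are
excluded. -/
lemma exists_separating_scalar (Z Y : Finset ℂ) (a b : ℂ) (ha : a ≠ 0) :
    ∃ r : ℂ, r ≠ 0 ∧ ∀ z ∈ Z, ∀ z' ∈ Z, ∀ y ∈ Y, ∀ y' ∈ Y,
      a * r * z - b * y = a * r * z' - b * y' → z = z' := by
  classical
  let F : Finset ℂ := insert 0 (((Z ×ˢ Z) ×ˢ (Y ×ˢ Y)).image
    fun t => b * (t.2.1 - t.2.2) / (a * (t.1.1 - t.1.2)))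
  obtain ⟨r, hr⟩ := Infinite.exists_notMem_finset F
  refine ⟨r, fun h => hr (by simp [F, h]), fun z hz z' hz' y hy y' hy' h => ?_⟩
  by_contra hne
  apply hr
  refine Finset.mem_insert_of_mem (Finset.mem_image.mpr ⟨((z, z'), (y, y')), by simp [*], ?_⟩)
  have hz0 : z - z' ≠ 0 := sub_ne_zero.mpr hne
  rw [div_eq_iff (mul_ne_zero ha hz0)]
  linear_combination -h

lemma exists_curvePoly_eq {A : Type*} [CommRing A] {e q : ℕ} (he : 2 ≤ e) (heq : e < q)
    (hmod : modality e q = 0) (a c : A) (hc : e = 2 → c = 0) :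
    ∃ ν : Idx e q → A, curvePoly ν = X 1 ^ e - X 0 ^ q + C a * X 0 - C c * X 1 := by
  classical
  have key : ∀ ν : Idx e q → A, curvePoly ν = X 1 ^ e - X 0 ^ q - ∑ k, C (ν k) * mono A k :=
    fun ν => by rw [curvePoly, weierstrassSupport_eq_univ he (by omega) hmod]
  have hs : ∀ (i : Idx e q) (r : A), ∑ k, C ((Pi.single i r : Idx e q → A) k) * mono A k = C r * mono A i := by
    intro i r
    rw [Finset.sum_eq_single i]
    · rw [Pi.single_eq_same]
    · intro k _ hk
      rw [Pi.single_eq_of_ne hk, C_0, zero_mul]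
    · simp
  let i₁ : Idx e q := (⟨1, by omega⟩, ⟨0, by omega⟩)
  have h₁ : mono A i₁ = X 0 := by simp [mono, i₁]
  rcases he.eq_or_lt with h2 | h3
  · refine ⟨Pi.single i₁ (-a), ?_⟩
    rw [key, hs, h₁, hc h2.symm, C_neg, C_0]
    ring
  · let i₂ : Idx e q := (⟨0, by omega⟩, ⟨1, by omega⟩)
    have h₂ : mono A i₂ = X 1 := by simp [mono, i₂]
    refine ⟨Pi.single i₁ (-a) + Pi.single i₂ c, ?_⟩
    simp only [key, Pi.add_apply, C_add, add_mul, Finset.sum_add_distrib, hs, h₁, h₂, C_neg]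
    ring

/-- There is a curve whose defining polynomial has `2g` nondegenerate critical points with
pairwise distinct critical values. -/
lemma exists_morse_curve {e q : ℕ} (he : 2 ≤ e) (heq : e < q) (hmod : modality e q = 0) :
    ∃ ν : Idx e q → ℂ,
      (∀ P : Fin 2 → ℂ, eval P (pderiv 0 (curvePoly ν)) = 0 →
        eval P (pderiv 1 (curvePoly ν)) = 0 → eval P (hess (curvePoly ν)) ≠ 0) ∧
      ∃ W : Finset ℂ, W.card = Fintype.card (Idx e q) ∧ ∀ w ∈ W, ∃ P : Fin 2 → ℂ,
        eval P (curvePoly ν) = w ∧ eval P (pderiv 0 (curvePoly ν)) = 0 ∧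
          eval P (pderiv 1 (curvePoly ν)) = 0 := by
  classical
  obtain ⟨c, Y, hYcard, hc, hY, hYne, hYinj⟩ := exists_critical_ordinates he
  have hq0 : (q : ℂ) ≠ 0 := Nat.cast_ne_zero.mpr (by omega)
  have he0 : (e : ℂ) ≠ 0 := Nat.cast_ne_zero.mpr (by omega)
  have hq1 : (q : ℂ) - 1 ≠ 0 := by
    rw [sub_ne_zero]
    exact_mod_cast (by omega : q ≠ 1)
  have he1 : (e : ℂ) - 1 ≠ 0 := by
    rw [sub_ne_zero]
    exact_mod_cast (by omega : e ≠ 1)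
  let Z := Polynomial.nthRootsFinset (q - 1) (1 : ℂ)
  have hZcard : Z.card = q - 1 :=
    (Complex.isPrimitiveRoot_exp (q - 1) (by omega)).card_nthRootsFinset
  obtain ⟨r, hr0, hr⟩ := exists_separating_scalar Z Y (q - 1) ((e - 1) * c) hq1
  obtain ⟨s, hs⟩ := IsAlgClosed.exists_pow_nat_eq r (show 0 < q by omega)
  have hs0 : s ≠ 0 := by
    rintro rfl
    rw [zero_pow (by omega)] at hs
    exact hr0 hs.symm
  -- The curve is `y ^ e - x ^ q + q s ^ (q-1) x - e c y`. Its critical points are `(s z, y)` with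
  -- `z ^ (q-1) = 1` and `y ^ (e-1) = c`; as `s ^ q = r`, the critical values are `(q-1) r z - (e-1)
  -- c y`.
  obtain ⟨ν, hν⟩ := exists_curvePoly_eq he heq hmod (q * s ^ (q - 1)) (e * c)
    (fun h => by rw [hc h, mul_zero])
  have hfx : pderiv 0 (curvePoly ν) = C (q * s ^ (q - 1)) - (q : MvPolynomial (Fin 2) ℂ) *
      X 0 ^ (q - 1) := by
    rw [hν]
    simp [Derivation.leibniz]
    ring
  have hfy : pderiv 1 (curvePoly ν) = (e : MvPolynomial (Fin 2) ℂ) * X 1 ^ (e - 1) - C (e * c) := by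
    rw [hν]
    simp [Derivation.leibniz]
  refine ⟨ν, ?_, (Z ×ˢ Y).image fun t => (q - 1) * r * t.1 - (e - 1) * c * t.2, ?_, ?_⟩
  · intro P h0 h1
    simp only [hfx, hfy, map_sub, map_mul, map_pow, eval_C, map_natCast, eval_X, ← mul_sub,
      mul_eq_zero, hq0, he0, false_or] at h0 h1
    have hx : P 0 ≠ 0 := by
      intro h
      rw [h, zero_pow (by omega), sub_zero] at h0
      exact pow_ne_zero _ hs0 h0
    have hy := hYne (P 1) (sub_eq_zero.mp h1)
    rw [hess, Matrix.det_fin_two_of, hfx, hfy]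
    have hqc : ((q - 1 : ℕ) : ℂ) ≠ 0 := Nat.cast_ne_zero.mpr (by omega)
    have hec : ((e - 1 : ℕ) : ℂ) ≠ 0 := Nat.cast_ne_zero.mpr (by omega)
    have hxp : P 0 ^ (q - 1 - 1) ≠ 0 := pow_ne_zero _ hx
    have hyp : P 1 ^ (e - 1 - 1) ≠ 0 := by
      rwa [show e - 1 - 1 = e - 2 by omega]
    simp [Derivation.leibniz, hqc, hec, hq0, he0, hxp,
      hyp, -Nat.cast_sub]
  · rw [Finset.card_image_of_injOn, Finset.card_product, hZcard, hYcard, Fintype.card_prod,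
      Fintype.card_fin, Fintype.card_fin]
    rintro ⟨z, y⟩ hzy ⟨z', y'⟩ hzy' h
    simp only [Finset.coe_product, Set.mem_prod, Finset.mem_coe] at hzy hzy'
    have hz := hr z hzy.1 z' hzy'.1 y hzy.2 y' hzy'.2 h
    subst hz
    refine Prod.ext rfl (hYinj y hzy.2 y' hzy'.2 ?_)
    refine mul_left_cancel₀ he1 ?_
    linear_combination -h
  · intro w hw
    obtain ⟨⟨z, y⟩, hzy, rfl⟩ := Finset.mem_image.mp hw
    rw [Finset.mem_product] at hzy
    have hz : z ^ (q - 1) = 1 := (Polynomial.mem_nthRootsFinset (by omega) _).mp hzy.1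
    have hy := hY y hzy.2
    have hz' : z ^ q = z := by
      rw [← Nat.sub_add_cancel (show 1 ≤ q by omega), pow_succ, hz, one_mul]
    have hs' : s ^ (q - 1) * s = r := by
      rw [← pow_succ, Nat.sub_add_cancel (show 1 ≤ q by omega), hs]
    have hy' : y ^ e = c * y := by
      rw [← Nat.sub_add_cancel (show 1 ≤ e by omega), pow_succ, hy]
    refine ⟨![s * z, y], ?_, ?_, ?_⟩
    · rw [hν]
      simp only [map_sub, map_add, map_mul, map_pow, eval_C, eval_X, Matrix.cons_val_zero,
        Matrix.cons_val_one, mul_pow, hz', hs, hy', map_natCast]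
      linear_combination q * z * hs'
    · rw [hfx]
      simp [mul_pow, hz]
    · rw [hfy]
      simp [hy]

end SpecialCurve

/-! ### The norm of `f` is squarefree. -/

section Squarefree

lemma squarefree_of_card_roots {K : Type*} [Field K] {p : Polynomial K} (hp : p.Monic)
    (W : Finset K) (hW : W.card = p.natDegree) (hroot : ∀ w ∈ W, p.eval w = 0) :
    Squarefree p := by
  have hdvd : ∏ w ∈ W, (Polynomial.X - Polynomial.C w) ∣ p := by
    refine Finset.prod_dvd_of_coprime ?_ fun w hw => Polynomial.dvd_iff_isRoot.mpr (hroot w hw)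
    exact fun a _ b _ hab => Polynomial.pairwise_coprime_X_sub_C Function.injective_id hab
  have heq : ∏ w ∈ W, (Polynomial.X - Polynomial.C w) = p := by
    refine (Polynomial.eq_of_monic_of_dvd_of_natDegree_le
      (Polynomial.monic_prod_of_monic _ _ fun w _ => Polynomial.monic_X_sub_C w) hp hdvd ?_).symm
    rw [Polynomial.natDegree_prod_of_monic _ _ fun w _ => Polynomial.monic_X_sub_C w]
    simp [hW]
  rw [← heq]
  exact (Polynomial.separable_prod_X_sub_C_iff'.mpr fun a _ b _ h => h).squarefree

variable {e q : ℕ} (he : 2 ≤ e) (hq : 2 ≤ q)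

lemma map_normPoly {A : Type*} [CommRing A] [Algebra ℚ A] (φ : ParamRing e q →+* A) :
    φ (normPoly he hq) = (mulMat he hq (fun k => φ (X k)) (curvePoly fun k => φ (X k))).det := by
  rw [normPoly, RingHom.map_det, RingHom.mapMatrix_apply, ← mulMat_map, genericPoly, map_curvePoly]
  rfl

/-- The determinant is already nonzero at the Morse curve, where the Hessian has no zero among the
critical points. -/
lemma det_mulMat_hess_ne_zero (heq : e < q) (hmod : modality e q = 0) :
    (mulMat he hq (fun k => (X k : ParamRing e q)) (hess (genericPoly e q))).det ≠ 0 := by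
  obtain ⟨ν, hν, -⟩ := exists_morse_curve he heq hmod
  intro h
  have h1 := congrArg (aeval ν : ParamRing e q →ₐ[ℚ] ℂ).toRingHom h
  rw [RingHom.map_det, RingHom.mapMatrix_apply, ← mulMat_map, map_zero,
    det_mulMat_eq_zero_iff] at h1
  obtain ⟨P, hP, h0, h1⟩ := h1
  have hcomp : ((aeval ν : ParamRing e q →ₐ[ℚ] ℂ).toRingHom ∘ fun k => X k) = ν := by
    funext k
    simp
  rw [hcomp] at h0 h1
  refine hν P h0 h1 ?_
  rw [← hP, hess, hess, Matrix.det_fin_two_of, Matrix.det_fin_two_of]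
  simp only [map_sub, map_mul, ← pderiv_map, genericPoly, map_curvePoly, hcomp]

/-- The substitution `μ₀ ↦ μ₀ + t` for the constant coefficient `μ₀`. -/
noncomputable def shiftConst (he : 2 ≤ e) (hq : 2 ≤ q) :
    ParamRing e q →+* Polynomial (ParamRing e q) :=
  (aeval fun k => Polynomial.C (X k) + if k = zeroIdx he hq then Polynomial.X else 0 :
    ParamRing e q →ₐ[ℚ] Polynomial (ParamRing e q)).toRingHom

lemma eval_zero_shiftConst (p : ParamRing e q) : (shiftConst he hq p).eval 0 = p := by
  have h : ((Polynomial.evalRingHom (0 : ParamRing e q)).comp (shiftConst he hq)) =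
      RingHom.id _ := by
    refine MvPolynomial.ringHom_ext (fun r => ?_) fun k => ?_
    · have h1 : shiftConst he hq (C r) = algebraMap ℚ _ r := (aeval _).commutes r
      rw [RingHom.comp_apply, h1, IsScalarTower.algebraMap_apply ℚ (ParamRing e q)]
      simp [algebraMap_eq]
    · by_cases hk : k = zeroIdx he hq <;> simp [shiftConst, hk]
  exact DFunLike.congr_fun h p

lemma zeroIdx_mem_support : zeroIdx he hq ∈ weierstrassSupport e q := by
  simp only [weierstrassSupport, zeroIdx, Finset.mem_filter, Finset.mem_univ, true_and]
  simp
  omega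

/-- The shift replaces `f` by `f - t` and leaves `f_x, f_y`, hence the Jacobian ring, unchanged; so
the norm becomes `det(a - t)`. -/
lemma shiftConst_normPoly :
    shiftConst he hq (normPoly he hq) = (-1) ^ Fintype.card (Idx e q) *
      (mulMat he hq (fun k => (X k : ParamRing e q)) (genericPoly e q)).charpoly := by
  set a := mulMat he hq (fun k => (X k : ParamRing e q)) (genericPoly e q) with ha
  have hcurve : curvePoly (fun k => shiftConst he hq (X k)) =
      map (Polynomial.C : ParamRing e q →+* _) (genericPoly e q) - C Polynomial.X := by
    rw [genericPoly, map_curvePoly, curvePoly, curvePoly]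
    have h : ∀ k : Idx e q, C (shiftConst he hq (X k)) * mono _ k =
        C (Polynomial.C (X k : ParamRing e q)) * mono _ k +
          if k = zeroIdx he hq then C Polynomial.X else 0 := by
      intro k
      by_cases hk : k = zeroIdx he hq
      · rw [hk]
        simp [shiftConst, mono_zeroIdx]
      · simp [shiftConst, hk]
    simp only [h, Finset.sum_add_distrib, Finset.sum_ite_eq', zeroIdx_mem_support he hq, if_true,
      Function.comp_apply]
    ring
  have hjac : jacIdeal (fun k => shiftConst he hq (X k)) =
      jacIdeal ((Polynomial.C : ParamRing e q →+* _) ∘ fun k : Idx e q => (X k : ParamRing e q)) := by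
    rw [jacIdeal, jacIdeal, hcurve, ← map_curvePoly]
    simp [genericPoly]
  have hC : mulMat he hq ((Polynomial.C : ParamRing e q →+* _) ∘ fun k => (X k : ParamRing e q))
      (C Polynomial.X) = algebraMap _ _ (Polynomial.X : Polynomial (ParamRing e q)) :=
    (mulMat he hq _).commutes _
  rw [map_normPoly, mulMat_congr he hq hjac, hcurve, map_sub, mulMat_map, hC, ← ha,
    Matrix.charpoly, ← Matrix.det_neg]
  congr 1
  rw [Matrix.charmatrix, neg_sub]
  rfl

lemma squarefree_normPoly (heq : e < q) (hmod : modality e q = 0) :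
    Squarefree (normPoly he hq) := by
  obtain ⟨ν, -, W, hWcard, hW⟩ := exists_morse_curve he heq hmod
  set a := mulMat he hq (fun k => (X k : ParamRing e q)) (genericPoly e q) with ha
  have hcomp : ((aeval ν : ParamRing e q →ₐ[ℚ] ℂ).toRingHom ∘ fun k => X k) = ν := by
    funext k
    simp
  have hamap : a.map (aeval ν : ParamRing e q →ₐ[ℚ] ℂ).toRingHom =
      mulMat he hq ν (curvePoly ν) := by
    rw [ha, ← mulMat_map, genericPoly, map_curvePoly, hcomp]
  have hsq : Squarefree (mulMat he hq ν (curvePoly ν)).charpoly := by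
    refine squarefree_of_card_roots (Matrix.charpoly_monic _) W
      (by rw [hWcard, Matrix.charpoly_natDegree_eq_dim]) fun w hw => ?_
    have hscalar : Matrix.scalar (Idx e q) w = mulMat he hq ν (C w) :=
      ((mulMat he hq ν).commutes w).symm
    rw [Matrix.eval_charpoly, hscalar, ← map_sub, det_mulMat_eq_zero_iff]
    obtain ⟨P, hP, h0, h1⟩ := hW w hw
    exact ⟨P, by simp [hP], h0, h1⟩
  intro p hp
  obtain ⟨r, hr⟩ := hp
  have hchar : (-1) ^ Fintype.card (Idx e q) * a.charpoly =
      shiftConst he hq p * shiftConst he hq p * shiftConst he hq r := by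
    rw [← shiftConst_normPoly, hr, map_mul, map_mul]
  -- A square factor `p * p` of the norm divides a polynomial monic up to sign, so the shifted `p`
  -- has unit leading coefficient and keeps its degree in `t` at the Morse curve. There the
  -- characteristic polynomial is squarefree, so that degree is `0`, and `p` is the unit itself.
  have hlead : IsUnit (shiftConst he hq p).leadingCoeff := by
    have h := congrArg Polynomial.leadingCoeff hchar
    rw [Polynomial.leadingCoeff_mul, Polynomial.leadingCoeff_mul, Polynomial.leadingCoeff_mul,
      (Matrix.charpoly_monic a).leadingCoeff, mul_one, mul_assoc] at h
    refine isUnit_of_dvd_unit (Dvd.intro _ h.symm) ?_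
    rw [Polynomial.leadingCoeff_pow, Polynomial.leadingCoeff_neg, Polynomial.leadingCoeff_one]
    exact (isUnit_one.neg).pow _
  set ev := (aeval ν : ParamRing e q →ₐ[ℚ] ℂ).toRingHom
  have hdeg : ((shiftConst he hq p).map ev).natDegree = (shiftConst he hq p).natDegree :=
    Polynomial.natDegree_map_of_leadingCoeff_ne_zero _ (hlead.map ev).ne_zero
  have hdvd : (shiftConst he hq p).map ev * (shiftConst he hq p).map ev ∣
      (mulMat he hq ν (curvePoly ν)).charpoly := by
    have h := congrArg (Polynomial.map ev) hchar
    rw [Polynomial.map_mul, Polynomial.map_mul, Polynomial.map_mul, ← Matrix.charpoly_map,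
      hamap] at h
    have h1 : IsUnit (((-1) ^ Fintype.card (Idx e q) : Polynomial (ParamRing e q)).map ev) := by
      simpa using (isUnit_one.neg).pow _
    rw [← h1.dvd_mul_left]
    exact Dvd.intro _ h.symm
  have hnat := Polynomial.natDegree_eq_zero_of_isUnit (hsq _ hdvd)
  rw [hdeg] at hnat
  rw [Polynomial.eq_C_of_natDegree_eq_zero hnat] at hlead
  rw [← eval_zero_shiftConst he hq p, Polynomial.eq_C_of_natDegree_eq_zero hnat,
    Polynomial.eval_C]
  rwa [Polynomial.leadingCoeff_C] at hlead

end Squarefree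

/-! ### Primitive integral multiples of rational polynomials. -/

section PrimitiveMultiple

/-- A nonzero rational polynomial has a nonzero multiple with integer coefficients of greatest
common divisor `1`. -/
lemma exists_primitive_multiple {σ : Type*} (p : MvPolynomial σ ℚ) (hp : p ≠ 0) :
    ∃ (D : MvPolynomial σ ℤ) (c : ℚ), c ≠ 0 ∧ map (Int.castRingHom ℚ) D = C c * p ∧
      ∀ d : ℤ, (∀ m, d ∣ coeff m D) → IsUnit d := by
  classical
  obtain ⟨b, hb⟩ := IsLocalization.exist_integer_multiples (nonZeroDivisors ℤ) p.support
    (fun m => coeff m p)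
  choose! n hn using hb
  have hn' : ∀ m ∈ p.support, (n m : ℚ) = (b : ℤ) * coeff m p := by
    intro m hm
    have h := hn m hm
    simpa [Algebra.smul_def] using h
  have hb0 : ((b : ℤ) : ℚ) ≠ 0 := by exact_mod_cast nonZeroDivisors.coe_ne_zero b
  have hsupp : p.support.Nonempty := support_nonempty.mpr hp
  obtain ⟨g, hg, hg1⟩ := Finset.extract_gcd n hsupp
  set G := p.support.gcd n with hG
  have hG0 : G ≠ 0 := by
    intro h
    obtain ⟨m, hm⟩ := hsupp
    have h1 := hn' m hm
    rw [hg m hm, h, zero_mul, Int.cast_zero, eq_comm] at h1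
    exact mem_support_iff.mp hm ((mul_eq_zero.mp h1).resolve_left hb0)
  have hG0' : (G : ℚ) ≠ 0 := by exact_mod_cast hG0
  have hcoeff : ∀ m, coeff m (∑ k ∈ p.support, monomial k (g k)) =
      if m ∈ p.support then g m else 0 := by
    intro m
    rw [coeff_sum]
    simp only [coeff_monomial]
    rw [Finset.sum_ite_eq']
  refine ⟨∑ m ∈ p.support, monomial m (g m), (b : ℤ) / G, div_ne_zero hb0 hG0', ?_, ?_⟩
  · ext m
    rw [coeff_map, hcoeff, coeff_C_mul]
    split_ifs with hm
    · have h1 := hn' m hm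
      rw [hg m hm, Int.cast_mul] at h1
      rw [eq_intCast, div_mul_eq_mul_div, ← h1, mul_div_cancel_left₀ _ hG0']
    · rw [notMem_support_iff.mp hm, mul_zero, map_zero]
  · intro d hd
    refine isUnit_of_dvd_one ?_
    rw [← hg1]
    refine Finset.dvd_gcd fun m hm => ?_
    have h := hd m
    rwa [hcoeff, if_pos hm] at h

end PrimitiveMultiple

/-! ### Identification of the discriminant with the norm. -/

section Discriminant

variable {e q : ℕ} (he : 2 ≤ e) (hq : 2 ≤ q)

lemma aeval_normPoly_eq_zero_iff (ν : Idx e q → ℂ) :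
    aeval ν (normPoly he hq) = 0 ↔ HasSingularPoint ν := by
  have h := map_normPoly he hq (aeval ν : ParamRing e q →ₐ[ℚ] ℂ).toRingHom
  have hν : (fun k => (aeval ν : ParamRing e q →ₐ[ℚ] ℂ).toRingHom (X k)) = ν := by
    funext k
    simp
  rw [hν] at h
  change aeval ν (normPoly he hq) = _ at h
  rw [h, det_mulMat_eq_zero_iff, HasSingularPoint]

lemma aeval_map_intCast {σ : Type*} (ν : σ → ℂ) (D : MvPolynomial σ ℤ) :
    aeval ν (map (Int.castRingHom ℚ) D) = aeval ν D :=
  aeval_map_algebraMap ℚ ν D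

lemma DetectsSingular.ne_zero {D : MvPolynomial (Idx e q) ℤ} (h : DetectsSingular e q D) :
    D ≠ 0 := by
  rintro rfl
  have := h.1 2 (by simp)
  rw [Int.isUnit_iff] at this
  omega

lemma totalDegree_map_intCast {σ : Type*} (D : MvPolynomial σ ℤ) :
    (map (Int.castRingHom ℚ) D).totalDegree = D.totalDegree := by
  rw [totalDegree, totalDegree, support_map_of_injective _ (Int.castRingHom ℚ).injective_int]

lemma exists_detectsSingular (hN : normPoly he hq ≠ 0) :
    ∃ D, DetectsSingular e q D ∧ D.totalDegree ≤ (normPoly he hq).totalDegree := by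
  obtain ⟨D, c, hc, hD, hprim⟩ := exists_primitive_multiple _ hN
  refine ⟨D, ⟨hprim, fun ν => ?_⟩, ?_⟩
  · rw [← aeval_map_intCast, hD, map_mul, ← aeval_normPoly_eq_zero_iff he hq]
    have : aeval ν (C c : ParamRing e q) ≠ 0 := by
      simpa using hc
    rw [mul_eq_zero, or_iff_right this]
  · rw [← totalDegree_map_intCast, hD]
    refine (totalDegree_mul _ _).trans ?_
    rw [totalDegree_C, zero_add]

lemma exists_isDiscriminant (hN : normPoly he hq ≠ 0) : ∃ D, IsDiscriminant e q D := by
  obtain ⟨D₀, hD₀, -⟩ := exists_detectsSingular he hq hN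
  obtain ⟨D, hD, hmin⟩ := WellFounded.has_min
    (measure (totalDegree : MvPolynomial (Idx e q) ℤ → ℕ)).wf {D | DetectsSingular e q D} ⟨D₀, hD₀⟩
  exact ⟨D, hD, fun D' hD' => not_lt.mp (hmin D' hD')⟩

/-- The discriminant is the norm of `f` up to a constant. -/
lemma IsDiscriminant.eq_C_mul_normPoly (hN : Squarefree (normPoly he hq))
    {D : MvPolynomial (Idx e q) ℤ} (hD : IsDiscriminant e q D) :
    ∃ c : ℚ, map (Int.castRingHom ℚ) D = C c * normPoly he hq := by
  set D' := map (Int.castRingHom ℚ) D with hD'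
  have hD0 : D' ≠ 0 := fun h =>
    hD.1.ne_zero (map_injective _ (Int.castRingHom ℚ).injective_int (by rw [← hD', h, map_zero]))
  have hmem : D' ∈ vanishingIdeal ℚ (zeroLocus ℂ (Ideal.span {normPoly he hq})) := by
    rw [mem_vanishingIdeal_iff]
    intro ν hν
    rw [hD', aeval_map_intCast, hD.1.2, ← aeval_normPoly_eq_zero_iff he hq]
    exact hν _ (Ideal.mem_span_singleton_self _)
  rw [vanishingIdeal_zeroLocus_eq_radical] at hmem
  obtain ⟨n, hn⟩ := hmem
  rw [Ideal.mem_span_singleton] at hn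
  have hdvd : normPoly he hq ∣ D' := by
    -- The exponent from the radical may be `0`, in which case the norm divides `1`.
    rcases eq_or_ne n 0 with rfl | hn0
    · rw [pow_zero] at hn
      exact hn.trans (one_dvd _)
    · exact (hN.dvd_pow_iff_dvd hn0).mp hn
  obtain ⟨r, hr⟩ := hdvd
  have hr0 : r ≠ 0 := by
    rintro rfl
    exact hD0 (by rw [hr, mul_zero])
  obtain ⟨D₀, hD₀, hdeg⟩ := exists_detectsSingular he hq hN.ne_zero
  -- The primitive multiple `D₀` of the norm competes for least degree, so the quotient `r` has
  -- total degree `0`.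
  have h1 := (hD.2 D₀ hD₀).trans hdeg
  rw [← totalDegree_map_intCast, ← hD', hr, totalDegree_mul_of_isDomain hN.ne_zero hr0] at h1
  refine ⟨coeff 0 r, ?_⟩
  rw [hr, mul_comm]
  congr 1
  exact totalDegree_eq_zero_iff_eq_C.mp (by omega)

end Discriminant

lemma opL_C_mul {e q : ℕ} (V : Matrix (Idx e q) (Idx e q) (ParamRing e q)) (c : ℚ)
    (D : ParamRing e q) : opL V (C c * D) = C (C c) * opL V D := by
  rw [opL, opL, Finset.mul_sum]
  refine Finset.sum_congr rfl fun k _ => ?_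
  have h := (rowField V k).map_smul c D
  rw [smul_eq_C_mul, smul_eq_C_mul] at h
  rw [h, C_mul, mul_assoc]

lemma jacobianIdeal_eq_jacIdeal (e q : ℕ) :
    jacobianIdeal e q = jacIdeal (fun k : Idx e q => (X k : ParamRing e q)) := rfl

end PlaneTelescopic

theorem mainTheorem6 (e q : ℕ) (he : 2 ≤ e) (heq : e < q) (hcop : Nat.Coprime e q)
    (hmod : PlaneTelescopic.modality e q = 0) :
    (∃ V, PlaneTelescopic.IsV e q V) ∧
    (∃ D, PlaneTelescopic.IsDiscriminant e q D) ∧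
    ∀ V, PlaneTelescopic.IsV e q V →
    ∀ D, PlaneTelescopic.IsDiscriminant e q D →
      Ideal.Quotient.mk (PlaneTelescopic.jacobianIdeal e q)
          (PlaneTelescopic.opL V (MvPolynomial.map (Int.castRingHom ℚ) D)) =
        Ideal.Quotient.mk (PlaneTelescopic.jacobianIdeal e q)
          (-PlaneTelescopic.hess (PlaneTelescopic.genericPoly e q) *
            MvPolynomial.C (MvPolynomial.map (Int.castRingHom ℚ) D)) := by
  open PlaneTelescopic in
  have hq : 2 ≤ q := by omega
  have hN := squarefree_normPoly he hq heq hmod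
  refine ⟨exists_isV he hq, exists_isDiscriminant he hq hN.ne_zero, fun V hV D hD => ?_⟩
  obtain ⟨c, hc⟩ := hD.eq_C_mul_normPoly he hq hN
  have h := mk_opL_normPoly he hq hmod (det_mulMat_hess_ne_zero he hq heq hmod) hV
  rw [← map_smul, ← map_neg, smul_eq_C_mul] at h
  have hmem := Ideal.Quotient.eq.mp h
  rw [hc, opL_C_mul, Ideal.Quotient.eq, jacobianIdeal_eq_jacIdeal]
  convert Ideal.mul_mem_left _ (C (C c)) hmem using 1
  rw [C_mul]
  ring
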